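/- **Theorem ($L^p$-almost-periodicity relative to a Bohr set).** *Conventions.* Let $G$ be a finite abelian group with dual group $\widehat G$ (the homomorphisms $G\to\mathbb{C}^\times$). A Bohr set $B$ is given by a set $\Gamma\subset\widehat G$ and a radius $\rho\ge 0$; its elements are the $x\in G$ with $|\gamma(x)-1|\le\rho$ for all $\gamma\in\Gamma$, and its rank is $|\Gamma|$. For $\tau\ge 0$, $B_\tau$ is the Bohr set with the same $\Gamma$ and radius $\tau\rho$. For Bohr sets $T$ with data $(\Lambda,\sigma)$ and $B$ with data $(\Gamma,\rho)$, $T\le B$ means $\Lambda\supset\Gamma$ and $\sigma\le\rho$. A Bohr set $B$ of rank $d$ is regular if $1-12d|\tau|\le |B_{1+\tau}|/|B|\le 1+12d|\tau|$ whenever $|\tau|\le 1/(12d)$. For a finite nonempty set $X \subset G$ write $1_X$ for its indicator function, $\mu_X=1_X/|X|$, $\mu_X(Y)=|Y|/|X|$ for $Y \subset X$, and $\|f\|_{L^p(X)}=\bigl(\frac1{|X|}\sum_{x\in X}|f(x)|^p\bigr)^{1/p}$; and $f*g(x)=\sum_y f(y)g(x-y)$. *Statement.* There are absolute constants $c,C>0$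 such that the following holds. Let $m\ge 1$ be real and $\epsilon,\delta\in(0,1)$. Let $A,L$ be nonempty subsets of a finite abelian group $G$ with $\eta:=|A|/|L|\le 1$, and let $B\subset G$ be a regular Bohr set of rank $d\ge 1$ and radius $\rho\le 2$. Let $\tau\ge 0$ satisfy $$\tau\le\frac{(c\delta)^{2m}}{d\log(2/\delta\eta)},$$ suppose that $B_\tau$ is regular, and suppose that $|A+S|\le K|A|$ for a nonempty subset $S\subset B_\tau$. Then there are a real number $d'>0$ with $$d'\le C\left(m\epsilon^{-2}\log^2(2/\delta\eta)\log(2K)+\log\bigl(1/\mu_{B_\tau}(S)\bigr)\right)$$ and a regular Bohr set $T\le B_\tau$ of rank at most $d+d'$ and radius at least $\rho\tau\delta\eta^{1/2}/(d^2d')$ such that, with $f=\mu_A*1_L\cdot(1-\mu_A*1_L)$, for every $t\in T$, $$\|\mu_A*1_L(\cdot+t)-\mu_A*1_L\|_{L^{2m}(B)}\le\epsilon\|f\|_{L^m(B)}^{1/2}+\epsilon^{2-1/m}\|f\|_{L^1(B)}^{1/2m}+\delta,$$ and moreover $$\|\mu_A*1_L*\mu_T-\mu_A*1_L\|_{L^{2m}(B)}\le\epsilon\|f\|_{L^m(B)}^{1/2}+\epsilon^{2-1/m}\|f\|_{L^1(B)}^{1/2m}+\delta.$$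 -/

import Mathlib

open scoped NNReal Pointwise

noncomputable section

/-- A Bohr set in `G`, with its defining data: a finite set of characters (the frequencies) and a
radius `ρ ≥ 0`. -/
structure BohrSet (G : Type*) [AddCommGroup G] where
  freq : Finset (AddChar G ℂ)
  radius : ℝ≥0

namespace BohrSet

variable {G : Type*} [AddCommGroup G]

/-- The rank of a Bohr set is the number of its frequencies. -/
def rank (B : BohrSet G) : ℕ := B.freq.card

open Classical in
/-- The underlying set `{x ∈ G : |γ(x) - 1| ≤ ρ for all γ ∈ Γ}`. -/
def carrier [Fintype G] (B : BohrSet G) : Finset G :=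
  Finset.univ.filter fun x => ∀ γ ∈ B.freq, ‖γ x - 1‖ ≤ (B.radius : ℝ)

/-- The Bohr set `B_τ` with the same frequencies and the radius multiplied by `τ`. -/
def dilate (B : BohrSet G) (τ : ℝ≥0) : BohrSet G := ⟨B.freq, τ * B.radius⟩

/-- `T.IsSub B` says that `T` is a sub-Bohr set of `B`, written `T ≤ B`. -/
def IsSub (T B : BohrSet G) : Prop := B.freq ⊆ T.freq ∧ T.radius ≤ B.radius

/-- Regularity of a Bohr set of rank `d`:
`1 - 12 d |τ| ≤ |B_{1+τ}| / |B| ≤ 1 + 12 d |τ|` whenever `|τ| ≤ 1 / (12 d)`. -/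
def IsRegular [Fintype G] (B : BohrSet G) : Prop :=
  ∀ τ : ℝ, |τ| ≤ 1 / (12 * (B.rank : ℝ)) →
    1 - 12 * (B.rank : ℝ) * |τ|
        ≤ ((B.dilate (1 + τ).toNNReal).carrier.card : ℝ) / (B.carrier.card : ℝ) ∧
      ((B.dilate (1 + τ).toNNReal).carrier.card : ℝ) / (B.carrier.card : ℝ)
        ≤ 1 + 12 * (B.rank : ℝ) * |τ|

end BohrSet

/-- The indicator function `1_X`. -/
def indFun {G : Type*} (X : Finset G) : G → ℝ := Set.indicator (X : Set G) 1

/-- The normalised indicator function `μ_X = 1_X / |X|`. -/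
def muFun {G : Type*} (X : Finset G) : G → ℝ := fun x => indFun X x / (X.card : ℝ)

/-- The convolution `f * g (x) = ∑ y, f(y) g(x - y)`. -/
def conv {G : Type*} [AddCommGroup G] [Fintype G] (f g : G → ℝ) : G → ℝ :=
  fun x => ∑ y, f y * g (x - y)

/-- The norm `‖f‖_{L^p(X)} = (𝔼_{x ∈ X} |f(x)|^p)^{1/p}`, for a finite set `X` and real `p`. -/
def avgLpNorm {G : Type*} (p : ℝ) (X : Finset G) (f : G → ℝ) : ℝ :=
  ((∑ x ∈ X, |f x| ^ p) / (X.card : ℝ)) ^ (1 / p)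

end

open scoped BigOperators

/-!
Croot–Sisask sampling: by a Rosenthal-type moment bound, the average of the translates of `1_L` by
`n` random elements of `A` is close to `g = μ_A * 1_L` in `L^{2m}(B)`, and since `|A + S| ≤ K|A|`,
pigeonholing over the samples yields one function `F` for which `F(· + s)` approximates `g` for all
`s` in a dense subset `X` of `S`. Consequently every difference of elements of `X` is an
almost-period of `g`, and so `g` is close in `L^{2m}(B)` to its iterated average `P` over `X - X`,
up to boundary effects that the regularity of `B` controls. The Fourier transform of `P` is that of
`g` damped by a power of the squared Fourier coefficients of `μ_X`. It therefore lives, up to a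
small error, on the large spectrum of `X`, and any `t` for which all `γ(t)` with `γ` in that
spectrum are close to `1` almost fixes `P`, hence `g`.

Chang's theorem relative to the regular Bohr set `B_τ` supplies such `t`: Riesz products show that a
subset of the large spectrum that is dissociated relative to `B_τ` has size
`O(log(|B_τ| / |X|))`, and adjoining a maximal one to the frequencies of `B_τ` gives, after
shrinking the radius to a regular value, a Bohr set `T` on which the whole large spectrum is almost
trivial.
-/

section LpNorm

variable {G : Type*} {p : ℝ}

/-- The unnormalised `ℓ^p` norm of a function on a finite set; unlike `avgLpNorm` it is monotone
in the set. -/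
noncomputable def lpNormOn (p : ℝ) (X : Finset G) (f : G → ℝ) : ℝ :=
  (∑ x ∈ X, |f x| ^ p) ^ (1 / p)

theorem sum_abs_rpow_nonneg (p : ℝ) (X : Finset G) (f : G → ℝ) : 0 ≤ ∑ x ∈ X, |f x| ^ p :=
  Finset.sum_nonneg fun _ _ => Real.rpow_nonneg (abs_nonneg _) _

theorem sum_abs_rpow_mono {X Y : Finset G} (h : X ⊆ Y) (f : G → ℝ) :
    ∑ x ∈ X, |f x| ^ p ≤ ∑ x ∈ Y, |f x| ^ p :=
  Finset.sum_le_sum_of_subset_of_nonneg h fun _ _ _ => Real.rpow_nonneg (abs_nonneg _) _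

theorem lpNormOn_nonneg (p : ℝ) (X : Finset G) (f : G → ℝ) : 0 ≤ lpNormOn p X f :=
  Real.rpow_nonneg (sum_abs_rpow_nonneg _ _ _) _

theorem avgLpNorm_eq_lpNormOn_div (p : ℝ) (X : Finset G) (f : G → ℝ) :
    avgLpNorm p X f = lpNormOn p X f / (X.card : ℝ) ^ (1 / p) :=
  Real.div_rpow (sum_abs_rpow_nonneg _ _ _) (Nat.cast_nonneg _) _

theorem lpNormOn_add_le (hp : 1 ≤ p) (X : Finset G) (f g : G → ℝ) :
    lpNormOn p X (f + g) ≤ lpNormOn p X f + lpNormOn p X g :=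
  Real.Lp_add_le X f g hp

theorem lpNormOn_const_mul (hp : 0 < p) (X : Finset G) (c : ℝ) (f : G → ℝ) :
    lpNormOn p X (fun x => c * f x) = |c| * lpNormOn p X f := by
  simp only [lpNormOn, abs_mul, Real.mul_rpow (abs_nonneg _) (abs_nonneg _), ← Finset.mul_sum]
  rw [Real.mul_rpow (Real.rpow_nonneg (abs_nonneg _) _) (sum_abs_rpow_nonneg _ _ _), one_div,
    Real.rpow_rpow_inv (abs_nonneg _) hp.ne']

theorem lpNormOn_sub_comm (p : ℝ) (X : Finset G) (f g : G → ℝ) :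
    lpNormOn p X (f - g) = lpNormOn p X (g - f) := by
  simp only [lpNormOn, Pi.sub_apply, abs_sub_comm]

theorem lpNormOn_mono (hp : 0 ≤ p) {X Y : Finset G} (h : X ⊆ Y) (f : G → ℝ) :
    lpNormOn p X f ≤ lpNormOn p Y f :=
  Real.rpow_le_rpow (sum_abs_rpow_nonneg _ _ _) (sum_abs_rpow_mono h f) (by positivity)

theorem lpNormOn_comp_le {H : Type*} (hp : 0 ≤ p) {X : Finset G} {Y : Finset H} {e : G → H}
    (he : Function.Injective e) (h : ∀ x ∈ X, e x ∈ Y) (f : H → ℝ) :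
    lpNormOn p X (f ∘ e) ≤ lpNormOn p Y f := by
  have hmap : lpNormOn p X (f ∘ e) = lpNormOn p (X.map ⟨e, he⟩) f := by
    simp only [lpNormOn, Finset.sum_map, Function.Embedding.coeFn_mk, Function.comp_apply]
  rw [hmap]
  exact lpNormOn_mono hp (Finset.map_subset_iff_subset_preimage.mpr fun x hx => by simp [h x hx]) f

theorem lpNormOn_expect_le (hp : 1 ≤ p) (X : Finset G) {ι : Type*} {I : Finset ι}
    (hI : I.Nonempty) (h : ι → G → ℝ) {D : ℝ} (hD : ∀ i ∈ I, lpNormOn p X (h i) ≤ D) :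
    lpNormOn p X (𝔼 i ∈ I, h i) ≤ D := by
  refine (Finset.le_expect_nonempty_of_subadditive (lpNormOn p X) (lpNormOn_add_le hp X)
    (fun n f => ?_) hI).trans (Finset.expect_le hI hD)
  have hn : (0 : ℝ) ≤ (n : ℝ)⁻¹ := by positivity
  have hsmul := lpNormOn_const_mul (by linarith : 0 < p) X (n : ℝ)⁻¹ f
  rw [abs_of_nonneg hn] at hsmul
  convert hsmul using 2
  · ext x
    simp [NNRat.smul_def]
  · simp [NNRat.smul_def]

theorem lpNormOn_le_of_abs_le (hp : 0 < p) {X : Finset G} {f : G → ℝ} {a : ℝ} (ha : 0 ≤ a)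
    (h : ∀ x ∈ X, |f x| ≤ a) : lpNormOn p X f ≤ a * (X.card : ℝ) ^ (1 / p) := by
  calc lpNormOn p X f ≤ (∑ _x ∈ X, a ^ p) ^ (1 / p) := by
        refine Real.rpow_le_rpow (sum_abs_rpow_nonneg _ _ _) ?_ (by positivity)
        gcongr with x hx
        exact h x hx
    _ = a * (X.card : ℝ) ^ (1 / p) := by
        rw [Finset.sum_const, nsmul_eq_mul, mul_comm, Real.mul_rpow (by positivity) (by positivity),
          one_div, Real.rpow_rpow_inv ha hp.ne']

theorem lpNormOn_le_add_sdiff [DecidableEq G] (hp : 1 ≤ p) (X Y : Finset G) (f : G → ℝ) :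
    lpNormOn p X f ≤ lpNormOn p Y f + lpNormOn p (X \ Y) f := by
  have hp0 : 0 < p := by linarith
  have hsplit : ∑ x ∈ X, |f x| ^ p ≤ ∑ x ∈ Y, |f x| ^ p + ∑ x ∈ X \ Y, |f x| ^ p := by
    rw [← Finset.sum_union Finset.disjoint_sdiff, Finset.union_sdiff_self_eq_union]
    exact sum_abs_rpow_mono Finset.subset_union_right f
  exact (Real.rpow_le_rpow (sum_abs_rpow_nonneg _ _ _) hsplit (by positivity)).trans
    (Real.rpow_add_le_add_rpow (sum_abs_rpow_nonneg _ _ _) (sum_abs_rpow_nonneg _ _ _)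
      (by positivity) ((div_le_one hp0).mpr hp))

end LpNorm

section Moments

theorem one_add_sq_div_two_le_cosh (y : ℝ) : 1 + y ^ 2 / 2 ≤ Real.cosh y := by
  have hsinh : (y / 2) ^ 2 ≤ Real.sinh (y / 2) ^ 2 := by
    rw [sq_le_sq, Real.abs_sinh, Real.self_le_sinh_iff]
    exact abs_nonneg _
  have hcosh : Real.cosh y = 1 + 2 * Real.sinh (y / 2) ^ 2 := by
    have hdouble := Real.cosh_two_mul (y / 2)
    rw [Real.cosh_sq, mul_div_cancel₀ y two_ne_zero] at hdouble
    linarith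
  linarith

theorem exp_le_mul_cosh_sub_one {y : ℝ} (hy : 1 ≤ y) : Real.exp y ≤ 8 * (Real.cosh y - 1) := by
  have hexp : 2.7 ≤ Real.exp y := by linarith [Real.exp_one_gt_d9, Real.exp_le_exp.mpr hy]
  rw [Real.cosh_eq]
  linarith [Real.exp_pos (-y)]

theorem rpow_le_rpow_self_mul_exp {p : ℝ} (hp : 0 < p) {y : ℝ} (hy : 0 ≤ y) :
    y ^ p ≤ p ^ p * Real.exp y := by
  have hdiv : y / p ≤ Real.exp (y / p) := by linarith [Real.add_one_le_exp (y / p)]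
  have hpow := Real.rpow_le_rpow (by positivity) hdiv hp.le
  rwa [Real.div_rpow hy hp.le, ← Real.exp_mul, div_mul_cancel₀ _ hp.ne',
    div_le_iff₀' (by positivity)] at hpow

theorem rpow_le_mul_cosh_sub_one {p : ℝ} (hp : 2 ≤ p) {y : ℝ} (hy : 0 ≤ y) :
    y ^ p ≤ 8 * p ^ p * (Real.cosh y - 1) := by
  have hp0 : 0 < p := by linarith
  rcases le_total y 1 with hy1 | hy1
  · have hpp : (1 : ℝ) ≤ p ^ p := Real.one_le_rpow (by linarith) hp0.le
    have hpow : y ^ p ≤ y ^ 2 := by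
      rw [← Real.rpow_two]
      exact Real.rpow_le_rpow_of_exponent_ge' hy hy1 (by norm_num) hp
    have hcosh := one_add_sq_div_two_le_cosh y
    have hcosh0 : 0 ≤ Real.cosh y - 1 := by linarith [Real.one_le_cosh y]
    linarith [mul_le_mul_of_nonneg_right hpp hcosh0]
  · calc y ^ p ≤ p ^ p * Real.exp y := rpow_le_rpow_self_mul_exp hp0 hy
      _ ≤ p ^ p * (8 * (Real.cosh y - 1)) := by
          gcongr
          exact exp_le_mul_cosh_sub_one hy1
      _ = 8 * p ^ p * (Real.cosh y - 1) := by ring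

theorem abs_rpow_le_mul_cosh_mul_sub_one {p t : ℝ} (hp : 2 ≤ p) (ht : 0 < t) (y : ℝ) :
    |y| ^ p ≤ 8 * (p / t) ^ p * (Real.cosh (t * y) - 1) := by
  have hscaled := rpow_le_mul_cosh_sub_one hp (by positivity : 0 ≤ |t * y|)
  rw [abs_mul, abs_of_pos ht, Real.mul_rpow ht.le (abs_nonneg _), ← abs_of_pos ht, ← abs_mul,
    Real.cosh_abs, abs_of_pos ht] at hscaled
  rw [Real.div_rpow (by linarith) ht.le]
  calc |y| ^ p = t ^ p * |y| ^ p / t ^ p := by field_simp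
    _ ≤ 8 * p ^ p * (Real.cosh (t * y) - 1) / t ^ p := by gcongr
    _ = 8 * (p ^ p / t ^ p) * (Real.cosh (t * y) - 1) := by ring

theorem exp_sub_one_le_mul_exp {s m : ℝ} (hs : 0 ≤ s) (hsm : s ≤ m) :
    Real.exp s - 1 ≤ s * Real.exp m :=
  calc Real.exp s - 1 = Real.exp s * (1 - Real.exp (-s)) := by
        rw [mul_sub, ← Real.exp_add, add_neg_cancel, Real.exp_zero, mul_one]
    _ ≤ Real.exp m * s := by
        have hexp : 0 ≤ 1 - Real.exp (-s) := by
          linarith [Real.exp_le_one_iff.mpr (neg_nonpos.mpr hs)]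
        gcongr
        linarith [Real.add_one_le_exp (-s)]
    _ = s * Real.exp m := mul_comm _ _

theorem exp_le_three_rpow {m : ℝ} (hm : 0 ≤ m) : Real.exp m ≤ 3 ^ m := by
  rw [← Real.exp_one_rpow]
  gcongr
  linarith [Real.exp_one_lt_d9]

variable {α : Type*} {A : Finset α} {v : α → ℝ}

theorem expect_exp_mul_le (hA : A.Nonempty) (hv : ∀ a ∈ A, |v a| ≤ 1) (hmean : 𝔼 a ∈ A, v a = 0)
    {t : ℝ} (ht : |t| ≤ 1) :
    𝔼 a ∈ A, Real.exp (t * v a) ≤ Real.exp (t ^ 2 * 𝔼 a ∈ A, v a ^ 2) := by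
  have hquad : ∀ a ∈ A, Real.exp (t * v a) ≤ 1 + t * v a + t ^ 2 * v a ^ 2 := by
    intro a ha
    have htv : |t * v a| ≤ 1 := by
      rw [abs_mul]
      exact mul_le_one₀ ht (abs_nonneg _) (hv a ha)
    have := (abs_le.mp (Real.abs_exp_sub_one_sub_id_le htv)).2
    rw [mul_pow] at this
    linarith
  calc 𝔼 a ∈ A, Real.exp (t * v a) ≤ 𝔼 a ∈ A, (1 + t * v a + t ^ 2 * v a ^ 2) :=
        Finset.expect_le_expect hquad
    _ = t ^ 2 * (𝔼 a ∈ A, v a ^ 2) + 1 := by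
        rw [Finset.expect_add_distrib, Finset.expect_add_distrib, ← Finset.mul_expect,
          ← Finset.mul_expect, hmean, Finset.expect_const hA]
        ring
    _ ≤ Real.exp (t ^ 2 * 𝔼 a ∈ A, v a ^ 2) := Real.add_one_le_exp _

theorem expect_piFinset_exp_mul_sum_le (hA : A.Nonempty) (hv : ∀ a ∈ A, |v a| ≤ 1)
    (hmean : 𝔼 a ∈ A, v a = 0) {t : ℝ} (ht : |t| ≤ 1) (n : ℕ) :
    𝔼 a ∈ Fintype.piFinset fun _ : Fin n => A, Real.exp (t * ∑ i, v (a i))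
      ≤ Real.exp (t ^ 2 * (n * 𝔼 a ∈ A, v a ^ 2)) := by
  simp only [Finset.mul_sum, Real.exp_sum]
  rw [← Finset.expect_pow A fun a => Real.exp (t * v a)]
  calc (𝔼 a ∈ A, Real.exp (t * v a)) ^ n ≤ Real.exp (t ^ 2 * 𝔼 a ∈ A, v a ^ 2) ^ n := by
        gcongr
        exact expect_exp_mul_le hA hv hmean ht
    _ = Real.exp (t ^ 2 * (n * 𝔼 a ∈ A, v a ^ 2)) := by
        rw [← Real.exp_nat_mul]
        ring_nf

theorem expect_piFinset_cosh_mul_sum_le (hA : A.Nonempty) (hv : ∀ a ∈ A, |v a| ≤ 1)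
    (hmean : 𝔼 a ∈ A, v a = 0) {t : ℝ} (ht : |t| ≤ 1) (n : ℕ) :
    𝔼 a ∈ Fintype.piFinset fun _ : Fin n => A, Real.cosh (t * ∑ i, v (a i))
      ≤ Real.exp (t ^ 2 * (n * 𝔼 a ∈ A, v a ^ 2)) := by
  have hpos := expect_piFinset_exp_mul_sum_le hA hv hmean ht n
  have hneg := expect_piFinset_exp_mul_sum_le hA hv hmean (t := -t) (by rwa [abs_neg]) n
  rw [neg_sq] at hneg
  simp only [Real.cosh_eq, ← neg_mul]
  rw [← Finset.expect_div, Finset.expect_add_distrib]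
  linarith

theorem expect_piFinset_abs_sum_rpow_le_exp (hA : A.Nonempty) (hv : ∀ a ∈ A, |v a| ≤ 1)
    (hmean : 𝔼 a ∈ A, v a = 0) {t : ℝ} (ht0 : 0 < t) (ht : t ≤ 1) (n : ℕ) {p : ℝ} (hp : 2 ≤ p) :
    𝔼 a ∈ Fintype.piFinset fun _ : Fin n => A, |∑ i, v (a i)| ^ p
      ≤ 8 * (p / t) ^ p * (Real.exp (t ^ 2 * (n * 𝔼 a ∈ A, v a ^ 2)) - 1) := by
  have hne : (Fintype.piFinset fun _ : Fin n => A).Nonempty :=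
    Fintype.piFinset_nonempty.mpr fun _ => hA
  calc 𝔼 a ∈ Fintype.piFinset fun _ : Fin n => A, |∑ i, v (a i)| ^ p
      ≤ 𝔼 a ∈ Fintype.piFinset fun _ : Fin n => A,
          8 * (p / t) ^ p * (Real.cosh (t * ∑ i, v (a i)) - 1) :=
        Finset.expect_le_expect fun a _ => abs_rpow_le_mul_cosh_mul_sub_one hp ht0 _
    _ = 8 * (p / t) ^ p *
          (𝔼 a ∈ Fintype.piFinset fun _ : Fin n => A, Real.cosh (t * ∑ i, v (a i)) - 1) := by
        rw [← Finset.mul_expect, Finset.expect_sub_distrib, Finset.expect_const hne]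
    _ ≤ 8 * (p / t) ^ p * (Real.exp (t ^ 2 * (n * 𝔼 a ∈ A, v a ^ 2)) - 1) := by
        gcongr
        exact expect_piFinset_cosh_mul_sum_le hA hv hmean (by rwa [abs_of_pos ht0]) n

variable {n : ℕ} {m : ℝ}

theorem expect_piFinset_abs_sum_rpow_le_of_variance_le (hA : A.Nonempty)
    (hv : ∀ a ∈ A, |v a| ≤ 1) (hmean : 𝔼 a ∈ A, v a = 0) (hm : 1 ≤ m)
    (hvar : n * 𝔼 a ∈ A, v a ^ 2 ≤ m) :
    𝔼 a ∈ Fintype.piFinset fun _ : Fin n => A, |∑ i, v (a i)| ^ (2 * m)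
      ≤ 8 * (12 * m ^ 2) ^ m * (n * 𝔼 a ∈ A, v a ^ 2) := by
  have hm0 : 0 < m := by linarith
  have hvar0 : 0 ≤ n * 𝔼 a ∈ A, v a ^ 2 :=
    mul_nonneg (Nat.cast_nonneg n) (Finset.expect_nonneg fun _ _ => sq_nonneg _)
  refine (expect_piFinset_abs_sum_rpow_le_exp hA hv hmean one_pos le_rfl n
    (by linarith : (2 : ℝ) ≤ 2 * m)).trans ?_
  rw [div_one, one_pow, one_mul]
  set s := n * 𝔼 a ∈ A, v a ^ 2
  calc 8 * (2 * m) ^ (2 * m) * (Real.exp s - 1)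
      ≤ 8 * (2 * m) ^ (2 * m) * (s * 3 ^ m) := by
        gcongr
        exact (exp_sub_one_le_mul_exp hvar0 hvar).trans (by gcongr; exact exp_le_three_rpow hm0.le)
    _ = 8 * ((2 * m) ^ (2 * m) * 3 ^ m) * s := by ring
    _ = 8 * (12 * m ^ 2) ^ m * s := by
        rw [Real.rpow_mul (by positivity), Real.rpow_two,
          ← Real.mul_rpow (by positivity) (by positivity)]
        ring_nf

theorem expect_piFinset_abs_sum_rpow_le_of_le_variance (hA : A.Nonempty)
    (hv : ∀ a ∈ A, |v a| ≤ 1) (hmean : 𝔼 a ∈ A, v a = 0) (hm : 1 ≤ m)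
    (hvar : m ≤ n * 𝔼 a ∈ A, v a ^ 2) :
    𝔼 a ∈ Fintype.piFinset fun _ : Fin n => A, |∑ i, v (a i)| ^ (2 * m)
      ≤ 8 * (12 * m * (n * 𝔼 a ∈ A, v a ^ 2)) ^ m := by
  have hm0 : 0 < m := by linarith
  have hvar0 : 0 < n * 𝔼 a ∈ A, v a ^ 2 := hm0.trans_le hvar
  have hmoment := fun t ht0 ht => expect_piFinset_abs_sum_rpow_le_exp hA hv hmean (t := t)
    ht0 ht n (by linarith : (2 : ℝ) ≤ 2 * m)
  set s := n * 𝔼 a ∈ A, v a ^ 2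
  -- the choice of `t` that balances `t ^ (-2 * m)` against `exp (t ^ 2 * s)`
  set t := √(m / s)
  have ht_sq : t ^ 2 = m / s := Real.sq_sqrt (by positivity)
  have hscale : (2 * m / t) ^ (2 * m) = (4 * m * s) ^ m := by
    rw [Real.rpow_mul (by positivity), Real.rpow_two, div_pow, ht_sq]
    congr 1
    field_simp
    ring
  refine (hmoment t (Real.sqrt_pos.mpr (by positivity))
    (Real.sqrt_le_one.mpr ((div_le_one hvar0).mpr hvar))).trans ?_
  rw [hscale, ht_sq, div_mul_cancel₀ _ hvar0.ne']
  calc 8 * (4 * m * s) ^ m * (Real.exp m - 1) ≤ 8 * (4 * m * s) ^ m * 3 ^ m := by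
        gcongr
        linarith [exp_le_three_rpow hm0.le]
    _ = 8 * (12 * m * s) ^ m := by
        rw [mul_assoc, ← Real.mul_rpow (by positivity) (by positivity)]
        ring_nf

theorem expect_piFinset_abs_sum_rpow_le (hA : A.Nonempty) (hv : ∀ a ∈ A, |v a| ≤ 1)
    (hmean : 𝔼 a ∈ A, v a = 0) (n : ℕ) (hm : 1 ≤ m) :
    𝔼 a ∈ Fintype.piFinset fun _ : Fin n => A, |∑ i, v (a i)| ^ (2 * m)
      ≤ 8 * (12 * m * (n * 𝔼 a ∈ A, v a ^ 2)) ^ m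
        + 8 * (12 * m ^ 2) ^ m * (n * 𝔼 a ∈ A, v a ^ 2) := by
  have : 0 ≤ 𝔼 a ∈ A, v a ^ 2 := Finset.expect_nonneg fun _ _ => sq_nonneg _
  rcases le_total (n * 𝔼 a ∈ A, v a ^ 2) m with hvar | hvar
  · exact (expect_piFinset_abs_sum_rpow_le_of_variance_le hA hv hmean hm hvar).trans
      (le_add_of_nonneg_left (by positivity))
  · exact (expect_piFinset_abs_sum_rpow_le_of_le_variance hA hv hmean hm hvar).trans
      (le_add_of_nonneg_right (by positivity))

variable {ε : ℝ}

theorem mul_rpow_variance_le (hm : 1 ≤ m) (hε : 0 < ε) {σ x : ℝ} (hσ : 0 ≤ σ) (hx : 0 < x)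
    (hxε : 96 * m ≤ x * ε ^ 2) :
    8 * (12 * m * (x * σ)) ^ m ≤ ε ^ (2 * m) * σ ^ m * x ^ (2 * m) := by
  calc 8 * (12 * m * (x * σ)) ^ m ≤ 8 ^ m * (12 * m * (x * σ)) ^ m := by
        gcongr
        exact Real.self_le_rpow_of_one_le (by norm_num) hm
    _ = (96 * m * (x * σ)) ^ m := by
        rw [← Real.mul_rpow (by positivity) (by positivity)]
        ring_nf
    _ ≤ (x * ε ^ 2 * (x * σ)) ^ m := by gcongr
    _ = (ε ^ 2 * σ * x ^ 2) ^ m := by ring_nf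
    _ = ε ^ (2 * m) * σ ^ m * x ^ (2 * m) := by
        rw [Real.mul_rpow (by positivity) (by positivity),
          Real.mul_rpow (by positivity) (by positivity), Real.rpow_mul hε.le, Real.rpow_mul hx.le,
          Real.rpow_two, Real.rpow_two]

theorem mul_twelve_rpow_mul_le (hm : 1 ≤ m) : 8 * 12 ^ m * m ≤ (192 : ℝ) ^ (2 * m - 1) := by
  have hexp : m ≤ 2 * m - 1 := by linarith
  have htwo : m ≤ 2 ^ m := by
    have := one_add_mul_self_le_rpow_one_add (by norm_num : (-1 : ℝ) ≤ 1) hm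
    norm_num at this
    linarith
  calc 8 * 12 ^ m * m ≤ 8 ^ m * 12 ^ m * 2 ^ m := by
        gcongr
        exact Real.self_le_rpow_of_one_le (by norm_num) hm
    _ = (192 : ℝ) ^ m := by
        rw [← Real.mul_rpow (by norm_num) (by norm_num),
          ← Real.mul_rpow (by norm_num) (by norm_num)]
        norm_num
    _ ≤ 192 ^ (2 * m - 1) := Real.rpow_le_rpow_of_exponent_le (by norm_num) hexp

theorem mul_rpow_sq_le (hm : 1 ≤ m) (hε : 0 < ε) {σ x : ℝ} (hσ : 0 ≤ σ) (hx : 0 < x)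
    (hxε : 192 * m ≤ x * ε ^ 2) :
    8 * (12 * m ^ 2) ^ m * (x * σ) ≤ ε ^ (4 * m - 2) * σ * x ^ (2 * m) := by
  have hm0 : 0 < m := by linarith
  calc 8 * (12 * m ^ 2) ^ m * (x * σ) = (8 * 12 ^ m * m) * m ^ (2 * m - 1) * (x * σ) := by
        rw [Real.mul_rpow (by norm_num) (by positivity), ← Real.rpow_two, ← Real.rpow_mul hm0.le,
          Real.rpow_sub_one hm0.ne']
        field_simp
    _ ≤ 192 ^ (2 * m - 1) * m ^ (2 * m - 1) * (x * σ) := by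
        gcongr
        exact mul_twelve_rpow_mul_le hm
    _ = (192 * m) ^ (2 * m - 1) * (x * σ) := by rw [Real.mul_rpow (by norm_num) hm0.le]
    _ ≤ (x * ε ^ 2) ^ (2 * m - 1) * (x * σ) := by
        gcongr
        linarith
    _ = ε ^ (4 * m - 2) * σ * x ^ (2 * m) := by
        rw [Real.mul_rpow hx.le (by positivity), Real.rpow_sub_one hx.ne', ← Real.rpow_two,
          ← Real.rpow_mul hε.le, show (2 : ℝ) * (2 * m - 1) = 4 * m - 2 by ring]
        field_simp

theorem expect_piFinset_abs_expect_rpow_le (hA : A.Nonempty) (hv : ∀ a ∈ A, |v a| ≤ 1)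
    (hmean : 𝔼 a ∈ A, v a = 0) (hm : 1 ≤ m) (hε : 0 < ε) (hn : 192 * m ≤ n * ε ^ 2) :
    𝔼 a ∈ Fintype.piFinset fun _ : Fin n => A, |𝔼 i, v (a i)| ^ (2 * m)
      ≤ ε ^ (2 * m) * (𝔼 a ∈ A, v a ^ 2) ^ m + ε ^ (4 * m - 2) * 𝔼 a ∈ A, v a ^ 2 := by
  have hn0 : (0 : ℝ) < n := pos_of_mul_pos_left (by linarith) (sq_nonneg ε)
  have hvar0 : 0 ≤ 𝔼 a ∈ A, v a ^ 2 := Finset.expect_nonneg fun _ _ => sq_nonneg _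
  simp only [Fintype.expect_eq_sum_div_card, Fintype.card_fin, abs_div, Nat.abs_cast,
    Real.div_rpow (abs_nonneg _) hn0.le]
  rw [← Finset.expect_div, div_le_iff₀ (by positivity), add_mul]
  exact (expect_piFinset_abs_sum_rpow_le hA hv hmean n hm).trans
    (add_le_add (mul_rpow_variance_le hm hε hvar0 hn0 (by linarith))
      (mul_rpow_sq_le hm hε hvar0 hn0 hn))

end Moments

section Sampling

section Variance

variable {α : Type*} {A : Finset α} {w : α → ℝ}

theorem expect_sq_sub_expect_le (hA : A.Nonempty) (hw0 : ∀ a ∈ A, 0 ≤ w a)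
    (hw1 : ∀ a ∈ A, w a ≤ 1) :
    𝔼 a ∈ A, (w a - 𝔼 b ∈ A, w b) ^ 2 ≤ (𝔼 a ∈ A, w a) * (1 - 𝔼 a ∈ A, w a) := by
  set g := 𝔼 b ∈ A, w b
  calc 𝔼 a ∈ A, (w a - g) ^ 2 ≤ 𝔼 a ∈ A, ((1 - 2 * g) * w a + g ^ 2) :=
        Finset.expect_le_expect fun a ha => by nlinarith [hw0 a ha, hw1 a ha]
    _ = (1 - 2 * g) * g + g ^ 2 := by
        rw [Finset.expect_add_distrib, ← Finset.mul_expect, Finset.expect_const hA]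
    _ = g * (1 - g) := by ring

theorem expect_piFinset_abs_expect_sub_rpow_le {n : ℕ} {m ε : ℝ} (hA : A.Nonempty)
    (hw0 : ∀ a ∈ A, 0 ≤ w a) (hw1 : ∀ a ∈ A, w a ≤ 1) (hm : 1 ≤ m) (hε : 0 < ε)
    (hn : 192 * m ≤ n * ε ^ 2) {g : ℝ} (hg : 𝔼 a ∈ A, w a = g) :
    𝔼 a ∈ Fintype.piFinset fun _ : Fin n => A, |𝔼 i, w (a i) - g| ^ (2 * m)
      ≤ ε ^ (2 * m) * (g * (1 - g)) ^ m + ε ^ (4 * m - 2) * (g * (1 - g)) := by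
  have hn0 : n ≠ 0 := by
    rintro rfl
    norm_num at hn
    linarith
  have : Nonempty (Fin n) := ⟨⟨0, Nat.pos_of_ne_zero hn0⟩⟩
  have hg0 : 0 ≤ g := hg ▸ Finset.expect_nonneg hw0
  have hg1 : g ≤ 1 := hg ▸ Finset.expect_le hA hw1
  have hbound : ∀ a ∈ A, |w a - g| ≤ 1 := fun a ha =>
    abs_le.mpr ⟨by linarith [hw0 a ha], by linarith [hw1 a ha]⟩
  have hmean : 𝔼 a ∈ A, (w a - g) = 0 := by
    rw [Finset.expect_sub_distrib, Finset.expect_const hA, hg, sub_self]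
  have hvar : 𝔼 a ∈ A, (w a - g) ^ 2 ≤ g * (1 - g) := hg ▸ expect_sq_sub_expect_le hA hw0 hw1
  have : 0 ≤ 𝔼 a ∈ A, (w a - g) ^ 2 := Finset.expect_nonneg fun _ _ => sq_nonneg _
  have hmoment := expect_piFinset_abs_expect_rpow_le hA hbound hmean hm hε hn
  simp only [Finset.expect_sub_distrib, Fintype.expect_const] at hmoment
  exact hmoment.trans (by gcongr)

end Variance

section Counting

open scoped Finset

variable {ι : Type*}

theorem card_le_two_mul_card_filter_le {s : Finset ι} {h : ι → ℝ} (h0 : ∀ i ∈ s, 0 ≤ h i) {Z : ℝ}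
    (hZ : 𝔼 i ∈ s, h i ≤ Z) : #s ≤ 2 * #{i ∈ s | h i ≤ 2 * Z} := by
  by_contra! hlt
  have hsplit := Finset.card_filter_add_card_filter_not (s := s) (fun i => h i ≤ 2 * Z)
  set bad := {i ∈ s | ¬ h i ≤ 2 * Z} with hbad
  have hcard : (#s : ℝ) ≤ 2 * #bad := by exact_mod_cast (by lia : #s ≤ 2 * #bad)
  have hbad_ne : bad.Nonempty := Finset.card_pos.mp (by lia)
  have hZ0 : 0 ≤ Z := (Finset.expect_nonneg h0).trans hZ
  have hlower : #bad * (2 * Z) < ∑ i ∈ bad, h i := by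
    rw [← nsmul_eq_mul, ← Finset.sum_const]
    exact Finset.sum_lt_sum_of_nonempty hbad_ne fun i hi => not_le.mp (Finset.mem_filter.mp hi).2
  have hupper : ∑ i ∈ bad, h i ≤ #s * Z :=
    calc ∑ i ∈ bad, h i ≤ ∑ i ∈ s, h i :=
          Finset.sum_le_sum_of_subset_of_nonneg (Finset.filter_subset _ _) fun i hi _ => h0 i hi
      _ = #s * 𝔼 i ∈ s, h i := by rw [Finset.card_mul_expect]
      _ ≤ #s * Z := by gcongr
  nlinarith

theorem sum_card_filter_sub_mem {H : Type*} [AddGroup H] [DecidableEq H] {P Ω : Finset H}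
    {S : Finset ι} {φ : ι → H} (h : ∀ s ∈ S, ∀ p ∈ P, p + φ s ∈ Ω) :
    ∑ b ∈ Ω, #{s ∈ S | b - φ s ∈ P} = #S * #P := by
  have hfiber : ∀ s ∈ S, #{b ∈ Ω | b - φ s ∈ P} = #P := fun s hs =>
    Finset.card_nbij' (· - φ s) (· + φ s) (fun b hb => (Finset.mem_filter.mp hb).2)
      (fun p hp => by simpa using ⟨h s hs p hp, hp⟩) (fun b _ => by simp) (fun p _ => by simp)
  calc ∑ b ∈ Ω, #{s ∈ S | b - φ s ∈ P} = ∑ s ∈ S, #{b ∈ Ω | b - φ s ∈ P} := by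
        simp only [Finset.card_filter]
        exact Finset.sum_comm
    _ = #S * #P := by rw [Finset.sum_congr rfl hfiber, Finset.sum_const, smul_eq_mul]

theorem exists_card_le_mul_card_filter_translate_mem {G : Type*} [AddCommGroup G] [DecidableEq G]
    {A S : Finset G} {K : ℝ} (hA : A.Nonempty) (hS : S.Nonempty) (hK : #(A + S) ≤ K * #A) {n : ℕ}
    {P : Finset (Fin n → G)} (hPA : P ⊆ Fintype.piFinset fun _ => A)
    (hP : #(Fintype.piFinset fun _ : Fin n => A) ≤ 2 * #P) :
    ∃ b : Fin n → G, #S ≤ 2 * K ^ n * #{s ∈ S | (fun i => b i - s) ∈ P} := by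
  set Ω := Fintype.piFinset fun _ : Fin n => A + S
  have hΩ : Ω.Nonempty := Fintype.piFinset_nonempty.mpr fun _ => hA.add hS
  have hcount : ∑ b ∈ Ω, #{s ∈ S | (fun i => b i - s) ∈ P} = #S * #P :=
    sum_card_filter_sub_mem (φ := Function.const (Fin n)) fun s hs p hp =>
      Fintype.mem_piFinset.mpr fun i =>
        Finset.add_mem_add (Fintype.mem_piFinset.mp (hPA hp) i) hs
  have hΩ_card : (#Ω : ℝ) ≤ 2 * K ^ n * #P :=
    calc (#Ω : ℝ) = #(A + S) ^ n := by rw [Fintype.card_piFinset_const, Nat.cast_pow]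
      _ ≤ (K * #A) ^ n := by gcongr
      _ = K ^ n * #(Fintype.piFinset fun _ : Fin n => A) := by
          rw [Fintype.card_piFinset_const, Nat.cast_pow, mul_pow]
      _ ≤ K ^ n * (2 * #P) := by
          have hK0 : 0 ≤ K := nonneg_of_mul_nonneg_left ((Nat.cast_nonneg _).trans hK)
            (Nat.cast_pos.mpr hA.card_pos)
          gcongr
          exact_mod_cast hP
      _ = 2 * K ^ n * #P := by ring
  obtain ⟨b, -, hb⟩ : ∃ b ∈ Ω, (#S : ℝ) ≤ 2 * K ^ n * #{s ∈ S | (fun i => b i - s) ∈ P} := by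
    refine Finset.exists_le_of_sum_le hΩ ?_
    rw [Finset.sum_const, nsmul_eq_mul, ← Finset.mul_sum, ← Nat.cast_sum, hcount]
    push_cast
    linarith [mul_le_mul_of_nonneg_right hΩ_card (Nat.cast_nonneg (α := ℝ) #S)]
  exact ⟨b, hb⟩

end Counting

section Convolution

variable {G : Type*}

theorem indFun_of_mem {X : Finset G} {x : G} (h : x ∈ X) : indFun X x = 1 := by
  simp [indFun, h]

theorem indFun_of_notMem {X : Finset G} {x : G} (h : x ∉ X) : indFun X x = 0 := by
  simp [indFun, h]

theorem indFun_nonneg (X : Finset G) (x : G) : 0 ≤ indFun X x :=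
  Set.indicator_nonneg (fun _ _ => zero_le_one) x

theorem indFun_le_one (X : Finset G) (x : G) : indFun X x ≤ 1 :=
  Set.indicator_le_self' (f := fun _ => (1 : ℝ)) (fun _ _ => zero_le_one) x

theorem sum_indFun_mul [Fintype G] (X : Finset G) (u : G → ℝ) :
    ∑ x, indFun X x * u x = ∑ x ∈ X, u x := by
  classical
  rw [← Finset.sum_subset (Finset.subset_univ X)]
  · exact Finset.sum_congr rfl fun x hx => by rw [indFun_of_mem hx, one_mul]
  · intro x _ hx
    rw [indFun_of_notMem hx, zero_mul]

theorem sum_muFun_sq [Fintype G] {A : Finset G} (hA : A.Nonempty) :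
    ∑ x, muFun A x ^ 2 = 1 / A.card := by
  have hcard : (A.card : ℝ) ≠ 0 := Nat.cast_ne_zero.mpr hA.card_pos.ne'
  calc ∑ x, muFun A x ^ 2 = ∑ x, indFun A x * (muFun A x / A.card) :=
        Finset.sum_congr rfl fun x _ => by simp only [muFun]; ring
    _ = ∑ x ∈ A, 1 / (A.card : ℝ) ^ 2 := by
        rw [sum_indFun_mul]
        refine Finset.sum_congr rfl fun x hx => ?_
        rw [muFun, indFun_of_mem hx, div_div, sq]
    _ = 1 / A.card := by
        rw [Finset.sum_const, nsmul_eq_mul]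
        field_simp

theorem sum_indFun_sq [Fintype G] (L : Finset G) : ∑ x, indFun L x ^ 2 = L.card := by
  simp only [sq]
  rw [sum_indFun_mul, Finset.sum_congr rfl fun x hx => indFun_of_mem hx]
  simp

variable [AddCommGroup G] [Fintype G] {A : Finset G} {u : G → ℝ}

theorem conv_muFun_left (A : Finset G) (u : G → ℝ) (x : G) :
    conv (muFun A) u x = 𝔼 y ∈ A, u (x - y) := by
  rw [Finset.expect_eq_sum_div_card, ← sum_indFun_mul A, Finset.sum_div]
  exact Finset.sum_congr rfl fun y _ => div_mul_eq_mul_div _ _ _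

theorem conv_comm (u v : G → ℝ) : conv u v = conv v u := by
  ext x
  refine Fintype.sum_equiv (Equiv.subLeft x) _ _ fun y => ?_
  simp [mul_comm]

theorem conv_muFun_right (A : Finset G) (u : G → ℝ) (x : G) :
    conv u (muFun A) x = 𝔼 y ∈ A, u (x - y) := by
  rw [conv_comm, conv_muFun_left]

theorem conv_muFun_nonneg (A : Finset G) (hu : ∀ x, 0 ≤ u x) (x : G) :
    0 ≤ conv (muFun A) u x := by
  rw [conv_muFun_left]
  exact Finset.expect_nonneg fun _ _ => hu _

theorem conv_muFun_le_one (hA : A.Nonempty) (hu : ∀ x, u x ≤ 1) (x : G) :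
    conv (muFun A) u x ≤ 1 := by
  rw [conv_muFun_left]
  exact Finset.expect_le hA fun _ _ => hu _

variable {m ε : ℝ} {n : ℕ}

theorem expect_piFinset_sum_abs_expect_sub_conv_rpow_le (hA : A.Nonempty) (hu0 : ∀ x, 0 ≤ u x)
    (hu1 : ∀ x, u x ≤ 1) (E : Finset G) (hm : 1 ≤ m) (hε : 0 < ε) (hn : 192 * m ≤ n * ε ^ 2)
    {g f : G → ℝ} (hg : g = conv (muFun A) u) (hf : f = fun x => g x * (1 - g x)) :
    𝔼 a ∈ Fintype.piFinset fun _ : Fin n => A, ∑ x ∈ E, |𝔼 i, u (x - a i) - g x| ^ (2 * m)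
      ≤ ε ^ (2 * m) * ∑ x ∈ E, |f x| ^ m + ε ^ (4 * m - 2) * ∑ x ∈ E, |f x| ^ (1 : ℝ) := by
  have hf0 : ∀ x, 0 ≤ f x := fun x => hf ▸ hg ▸ mul_nonneg (conv_muFun_nonneg A hu0 x)
    (sub_nonneg.mpr (conv_muFun_le_one hA hu1 x))
  simp only [abs_of_nonneg (hf0 _), Real.rpow_one]
  rw [Finset.expect_sum_comm, Finset.mul_sum, Finset.mul_sum, ← Finset.sum_add_distrib]
  refine Finset.sum_le_sum fun x _ => ?_
  simp only [hf]
  exact expect_piFinset_abs_expect_sub_rpow_le (w := fun a => u (x - a)) hA (fun _ _ => hu0 _)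
    (fun _ _ => hu1 _) hm hε hn (by rw [hg, conv_muFun_left])

theorem rpow_two_mul_add_le (hm : 1 ≤ m) (hε : 0 < ε) {a b : ℝ} (ha : 0 ≤ a) (hb : 0 ≤ b) :
    (2 * (ε ^ (2 * m) * a + ε ^ (4 * m - 2) * b)) ^ (1 / (2 * m))
      ≤ 2 * (ε * (a ^ (1 / m)) ^ (1 / 2 : ℝ) + ε ^ (2 - 1 / m) * b ^ (1 / (2 * m))) := by
  have : 0 < m := by linarith
  have hexp : (1 : ℝ) / (2 * m) ≤ 1 := by rw [div_le_one (by positivity)]; linarith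
  have htwo : (2 : ℝ) ^ (1 / (2 * m)) ≤ 2 := by
    simpa using Real.rpow_le_rpow_of_exponent_le (by norm_num : (1 : ℝ) ≤ 2) hexp
  have hfirst : (ε ^ (2 * m) * a) ^ (1 / (2 * m)) = ε * (a ^ (1 / m)) ^ (1 / 2 : ℝ) := by
    rw [Real.mul_rpow (by positivity) ha, ← Real.rpow_mul hε.le, ← Real.rpow_mul ha,
      mul_one_div_cancel (by positivity), Real.rpow_one]
    congr 2
    field_simp
  have hsecond : (ε ^ (4 * m - 2) * b) ^ (1 / (2 * m)) = ε ^ (2 - 1 / m) * b ^ (1 / (2 * m)) := by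
    rw [Real.mul_rpow (by positivity) hb, ← Real.rpow_mul hε.le]
    congr 2
    field_simp
    ring
  rw [Real.mul_rpow (by norm_num) (by positivity), ← hfirst, ← hsecond]
  gcongr
  exact Real.rpow_add_le_add_rpow (by positivity) (by positivity) (by positivity) hexp

theorem exists_translates_lpNormOn_le [DecidableEq G] {K : ℝ} {S : Finset G} (hA : A.Nonempty)
    (hS : S.Nonempty) (hK : ((A + S).card : ℝ) ≤ K * A.card) (hu0 : ∀ x, 0 ≤ u x)
    (hu1 : ∀ x, u x ≤ 1) (E : Finset G) (hm : 1 ≤ m) (hε : 0 < ε) (hn : 192 * m ≤ n * ε ^ 2)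
    {g f : G → ℝ} (hg : g = conv (muFun A) u) (hf : f = fun x => g x * (1 - g x)) :
    ∃ X ⊆ S, (S.card : ℝ) ≤ 2 * K ^ n * X.card ∧ ∃ F : G → ℝ, ∀ s ∈ X,
      lpNormOn (2 * m) E (fun x => F (x + s) - g x)
        ≤ 2 * (ε * lpNormOn m E f ^ (1 / 2 : ℝ)
            + ε ^ (2 - 1 / m) * lpNormOn 1 E f ^ (1 / (2 * m))) := by
  have hhalf := card_le_two_mul_card_filter_le (fun a _ => sum_abs_rpow_nonneg _ _ _)
    (expect_piFinset_sum_abs_expect_sub_conv_rpow_le hA hu0 hu1 E hm hε hn hg hf)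
  obtain ⟨b, hb⟩ := exists_card_le_mul_card_filter_translate_mem hA hS hK
    (Finset.filter_subset _ _) hhalf
  refine ⟨_, Finset.filter_subset _ _, hb, fun x => 𝔼 i, u (x - b i), fun s hs => ?_⟩
  have hgood := (Finset.mem_filter.mp (Finset.mem_filter.mp hs).2).2
  simp only [sub_sub_eq_add_sub] at hgood
  unfold lpNormOn
  rw [one_div_one, Real.rpow_one]
  exact (Real.rpow_le_rpow (sum_abs_rpow_nonneg _ _ _) hgood (by positivity)).trans
    (rpow_two_mul_add_le hm hε (sum_abs_rpow_nonneg _ _ _) (sum_abs_rpow_nonneg _ _ _))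

end Convolution

end Sampling

section DifferenceAverage

variable {G : Type*} [AddCommGroup G] {X : Finset G}

/-- The convolution `h * μ_X * μ_{-X}`, that is the average of the translates of `h` by the
differences of elements of `X`. -/
noncomputable def diffAverage (X : Finset G) (h : G → ℝ) : G → ℝ :=
  fun x => 𝔼 q ∈ X ×ˢ X, h (x + (q.1 - q.2))

theorem diffAverage_sub (X : Finset G) (h h' : G → ℝ) :
    diffAverage X (h - h') = diffAverage X h - diffAverage X h' := by
  ext x
  exact Finset.expect_sub_distrib _ _ _

theorem diffAverage_eq_expect (X : Finset G) (h : G → ℝ) :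
    diffAverage X h = 𝔼 q ∈ X ×ˢ X, h ∘ (· + (q.1 - q.2)) := by
  ext x
  simp only [diffAverage, Finset.expect, Pi.smul_apply, Finset.sum_apply, Function.comp_apply]

variable {p : ℝ} {E : ℕ → Finset G} {g : G → ℝ} {D : ℝ}

theorem lpNormOn_translate_diff_sub_le (hp : 1 ≤ p) {E₀ E₁ : Finset G} {F : G → ℝ}
    (hF : ∀ s ∈ X, lpNormOn p E₀ (fun x => F (x + s) - g x) ≤ D) (hE : E₁ ⊆ E₀)
    (hE' : ∀ x ∈ E₁, ∀ s ∈ X, ∀ t ∈ X, x + (s - t) ∈ E₀) {s t : G} (hs : s ∈ X) (ht : t ∈ X) :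
    lpNormOn p E₁ (fun x => g (x + (s - t)) - g x) ≤ 2 * D := by
  have hp0 : 0 ≤ p := by linarith
  have hshift : lpNormOn p E₁ (fun x => F (x + s) - g (x + (s - t))) ≤ D := by
    have hcomp := lpNormOn_comp_le hp0 (add_left_injective (s - t))
      (fun x hx => hE' x hx s hs t ht) (fun x => F (x + t) - g x)
    simp only [Function.comp_def, add_assoc, sub_add_cancel] at hcomp
    exact hcomp.trans (hF t ht)
  calc lpNormOn p E₁ (fun x => g (x + (s - t)) - g x)
      = lpNormOn p E₁ ((fun x => g (x + (s - t)) - F (x + s)) + fun x => F (x + s) - g x) := by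
        congr 1
        ext x
        simp
    _ ≤ lpNormOn p E₁ ((fun x => g (x + (s - t))) - fun x => F (x + s))
          + lpNormOn p E₁ (fun x => F (x + s) - g x) := lpNormOn_add_le hp _ _ _
    _ ≤ D + D := by
        rw [lpNormOn_sub_comm]
        exact add_le_add hshift ((lpNormOn_mono hp0 hE _).trans (hF s hs))
    _ = 2 * D := (two_mul D).symm

theorem lpNormOn_diffAverage_le (hp : 1 ≤ p) (hX : X.Nonempty) {E₀ E₁ : Finset G}
    (hE : ∀ x ∈ E₁, ∀ s ∈ X, ∀ t ∈ X, x + (s - t) ∈ E₀) (h : G → ℝ) :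
    lpNormOn p E₁ (diffAverage X h) ≤ lpNormOn p E₀ h := by
  rw [diffAverage_eq_expect]
  refine lpNormOn_expect_le hp _ (hX.product hX) _ fun q hq => ?_
  obtain ⟨hq₁, hq₂⟩ := Finset.mem_product.mp hq
  exact lpNormOn_comp_le (by linarith) (add_left_injective _)
    (fun x hx => hE x hx q.1 hq₁ q.2 hq₂) h

theorem lpNormOn_diffAverage_sub_le (hp : 1 ≤ p) (hX : X.Nonempty) {E₀ : Finset G}
    (hD : ∀ s ∈ X, ∀ t ∈ X, lpNormOn p E₀ (fun x => g (x + (s - t)) - g x) ≤ D) :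
    lpNormOn p E₀ (diffAverage X g - g) ≤ D := by
  have hsub : diffAverage X g - g = 𝔼 q ∈ X ×ˢ X, (g ∘ (· + (q.1 - q.2)) - g) := by
    rw [Finset.expect_sub_distrib, Finset.expect_const (hX.product hX), diffAverage_eq_expect]
  rw [hsub]
  refine lpNormOn_expect_le hp _ (hX.product hX) _ fun q hq => ?_
  obtain ⟨hq₁, hq₂⟩ := Finset.mem_product.mp hq
  exact hD q.1 hq₁ q.2 hq₂

theorem lpNormOn_iterate_diffAverage_sub_le (hp : 1 ≤ p) (hX : X.Nonempty) (hE₀ : ∀ j, E j ⊆ E 0)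
    {k : ℕ} (hE : ∀ j < k, ∀ x ∈ E (j + 1), ∀ s ∈ X, ∀ t ∈ X, x + (s - t) ∈ E j)
    (hD : ∀ s ∈ X, ∀ t ∈ X, lpNormOn p (E 0) (fun x => g (x + (s - t)) - g x) ≤ D) :
    lpNormOn p (E k) ((diffAverage X)^[k] g - g) ≤ k * D := by
  have hp0 : 0 < p := by linarith
  induction k with
  | zero => simp [lpNormOn, hp0.ne']
  | succ k ih =>
    have hsplit : (diffAverage X)^[k + 1] g - g
        = diffAverage X ((diffAverage X)^[k] g - g) + (diffAverage X g - g) := by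
      rw [diffAverage_sub, Function.iterate_succ_apply', sub_add_sub_cancel]
    calc lpNormOn p (E (k + 1)) ((diffAverage X)^[k + 1] g - g)
        ≤ lpNormOn p (E (k + 1)) (diffAverage X ((diffAverage X)^[k] g - g))
            + lpNormOn p (E (k + 1)) (diffAverage X g - g) :=
          hsplit ▸ lpNormOn_add_le hp _ _ _
      _ ≤ lpNormOn p (E k) ((diffAverage X)^[k] g - g) + lpNormOn p (E 0) (diffAverage X g - g) :=
          add_le_add (lpNormOn_diffAverage_le hp hX (hE k k.lt_succ_self) _)
            (lpNormOn_mono hp0.le (hE₀ _) _)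
      _ ≤ k * D + D := add_le_add (ih fun j hj => hE j (hj.trans k.lt_succ_self))
            (lpNormOn_diffAverage_sub_le hp hX hD)
      _ = (k + 1 : ℕ) * D := by push_cast; ring

end DifferenceAverage

section Fourier

variable {G : Type*} [AddCommGroup G] [Fintype G]

/-- The Fourier transform of a real function on a finite abelian group, with the unnormalised sum
over the group; sums over the dual group are accordingly normalised. -/
noncomputable def discreteFourier (u : G → ℝ) (γ : AddChar G ℂ) : ℂ := ∑ x, u x * γ (-x)

theorem expect_discreteFourier_mul (u : G → ℝ) (x : G) :
    𝔼 γ, discreteFourier u γ * γ x = u x := by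
  classical
  calc 𝔼 γ, discreteFourier u γ * γ x = 𝔼 γ : AddChar G ℂ, ∑ y, u y * γ (x - y) := by
        refine Finset.expect_congr rfl fun γ _ => ?_
        rw [discreteFourier, Finset.sum_mul]
        refine Finset.sum_congr rfl fun y _ => ?_
        rw [mul_assoc, ← AddChar.map_add_eq_mul, neg_add_eq_sub]
    _ = u x := by
        rw [Finset.expect_sum_comm]
        simp [← Finset.mul_expect, AddChar.expect_apply_eq_ite, sub_eq_zero]

theorem discreteFourier_conv (u v : G → ℝ) (γ : AddChar G ℂ) :
    discreteFourier (conv u v) γ = discreteFourier u γ * discreteFourier v γ := by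
  have hshift : ∀ y, ∑ x, (v (x - y) : ℂ) * γ (-x) = γ (-y) * discreteFourier v γ := by
    intro y
    rw [discreteFourier, Finset.mul_sum, ← Equiv.sum_comp (Equiv.addRight y)]
    refine Finset.sum_congr rfl fun z _ => ?_
    rw [Equiv.coe_addRight, add_sub_cancel_right, neg_add, AddChar.map_add_eq_mul]
    ring
  calc discreteFourier (conv u v) γ = ∑ y, ∑ x, u y * (v (x - y) * γ (-x)) := by
        rw [Finset.sum_comm]
        refine Finset.sum_congr rfl fun x _ => ?_
        simp only [conv, Complex.ofReal_sum, Complex.ofReal_mul, Finset.sum_mul, mul_assoc]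
    _ = discreteFourier u γ * discreteFourier v γ := by
        simp only [← Finset.mul_sum, hshift]
        simp only [← mul_assoc, ← Finset.sum_mul]
        rfl

theorem expect_norm_sq_discreteFourier (u : G → ℝ) :
    𝔼 γ, ‖discreteFourier u γ‖ ^ 2 = ∑ x, u x ^ 2 := by
  have hconj : ∀ γ : AddChar G ℂ, ((‖discreteFourier u γ‖ ^ 2 : ℝ) : ℂ)
      = ∑ x, u x * (discreteFourier u γ * γ x) := by
    intro γ
    rw [Complex.ofReal_pow, ← Complex.mul_conj', discreteFourier, map_sum, Finset.mul_sum]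
    refine Finset.sum_congr rfl fun x _ => ?_
    rw [map_mul, Complex.conj_ofReal, ← AddChar.map_neg_eq_conj, neg_neg]
    ring
  have hcomplex : ((𝔼 γ, ‖discreteFourier u γ‖ ^ 2 : ℝ) : ℂ) = ((∑ x, u x ^ 2 : ℝ) : ℂ) := by
    rw [Complex.ofReal_expect, Finset.expect_congr rfl fun γ _ => hconj γ, Finset.expect_sum_comm]
    simp only [← Finset.mul_expect, expect_discreteFourier_mul, Complex.ofReal_sum,
      sq, Complex.ofReal_mul]
  exact_mod_cast hcomplex

theorem expect_norm_discreteFourier_conv_le (u v : G → ℝ) :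
    𝔼 γ, ‖discreteFourier (conv u v) γ‖ ≤ √(∑ x, u x ^ 2) * √(∑ x, v x ^ 2) := by
  simp only [discreteFourier_conv, norm_mul, ← expect_norm_sq_discreteFourier]
  rw [← Real.sqrt_mul (Finset.expect_nonneg fun _ _ => sq_nonneg _)]
  exact Real.le_sqrt_of_sq_le (Finset.expect_mul_sq_le_sq_mul_sq _ _ _)

theorem expect_norm_discreteFourier_conv_muFun_indFun_le {A : Finset G} (hA : A.Nonempty)
    (L : Finset G) :
    𝔼 γ, ‖discreteFourier (conv (muFun A) (indFun L)) γ‖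
      ≤ 1 / √((A.card : ℝ) / L.card) := by
  refine (expect_norm_discreteFourier_conv_le _ _).trans_eq ?_
  rw [sum_muFun_sq hA, sum_indFun_sq, ← Real.sqrt_mul (by positivity), ← Real.sqrt_one,
    ← Real.sqrt_div zero_le_one, Real.sqrt_one]
  congr 1
  rw [one_div_div, one_div_mul_eq_div]

end Fourier

section Spectrum

variable {G : Type*} [AddCommGroup G]

/-- The Fourier coefficient `𝔼_{x ∈ X} γ(x)` of the normalised indicator function of `X`, up to
conjugation. -/
noncomputable def muHat (X : Finset G) (γ : AddChar G ℂ) : ℂ := 𝔼 x ∈ X, γ x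

variable [Finite G]

theorem norm_addChar_apply_sub_one_le_two (γ : AddChar G ℂ) (x : G) : ‖γ x - 1‖ ≤ 2 := by
  refine (norm_sub_le _ _).trans ?_
  rw [AddChar.norm_apply, norm_one]
  norm_num

theorem norm_muHat_le_one (X : Finset G) (γ : AddChar G ℂ) : ‖muHat X γ‖ ≤ 1 := by
  rcases X.eq_empty_or_nonempty with rfl | hX
  · simp [muHat]
  · exact (RCLike.norm_expect_le (K := ℂ)).trans
      (Finset.expect_le hX fun x _ => (AddChar.norm_apply γ x).le)

theorem expect_addChar_neg (X : Finset G) (γ : AddChar G ℂ) :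
    𝔼 x ∈ X, γ (-x) = (starRingEnd ℂ) (muHat X γ) := by
  rw [muHat, Finset.expect_eq_sum_div_card, Finset.expect_eq_sum_div_card, map_div₀, map_sum,
    Complex.conj_natCast]
  simp only [AddChar.map_neg_eq_conj]

theorem expect_addChar_sub (X : Finset G) (γ : AddChar G ℂ) :
    𝔼 q ∈ X ×ˢ X, γ (q.1 - q.2) = ((‖muHat X γ‖ ^ 2 : ℝ) : ℂ) := by
  rw [Complex.ofReal_pow, ← Complex.mul_conj', ← expect_addChar_neg, muHat,
    Finset.expect_mul_expect, Finset.expect_product]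
  simp only [sub_eq_add_neg, AddChar.map_add_eq_mul]

theorem norm_muHat_sq_pow_mul_norm_sub_one_le (X : Finset G) {κ : ℝ} {t : G} (hκ : 0 ≤ κ)
    {γ : AddChar G ℂ} (ht : 1 / 2 ≤ ‖muHat X γ‖ → ‖γ t - 1‖ ≤ κ) (k : ℕ) :
    (‖muHat X γ‖ ^ 2) ^ k * ‖γ t - 1‖ ≤ κ + 2 * (1 / 4) ^ k := by
  rcases le_total (1 / 2) ‖muHat X γ‖ with hlarge | hsmall
  · calc (‖muHat X γ‖ ^ 2) ^ k * ‖γ t - 1‖ ≤ 1 * κ := by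
          gcongr
          · exact pow_le_one₀ (by positivity) (pow_le_one₀ (norm_nonneg _) (norm_muHat_le_one X γ))
          · exact ht hlarge
      _ ≤ κ + 2 * (1 / 4) ^ k := by
          rw [one_mul]
          exact le_add_of_nonneg_right (by positivity)
  · calc (‖muHat X γ‖ ^ 2) ^ k * ‖γ t - 1‖ ≤ ((1 / 2) ^ 2) ^ k * 2 := by
          gcongr
          exact norm_addChar_apply_sub_one_le_two γ t
      _ = 2 * (1 / 4) ^ k := by norm_num [mul_comm]
      _ ≤ κ + 2 * (1 / 4) ^ k := le_add_of_nonneg_left hκ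

end Spectrum

section AlmostPeriodicity

variable {G : Type*} [AddCommGroup G] [Fintype G]

theorem discreteFourier_diffAverage (X : Finset G) (g : G → ℝ) (γ : AddChar G ℂ) :
    discreteFourier (diffAverage X g) γ = (‖muHat X γ‖ ^ 2 : ℝ) * discreteFourier g γ := by
  have hshift : ∀ z : G, ∑ x, (g (x + z) : ℂ) * γ (-x) = γ z * discreteFourier g γ := by
    intro z
    rw [discreteFourier, Finset.mul_sum, ← Equiv.sum_comp (Equiv.subRight z)]
    refine Finset.sum_congr rfl fun y _ => ?_
    rw [Equiv.subRight_apply, sub_add_cancel, neg_sub, sub_eq_add_neg, AddChar.map_add_eq_mul]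
    ring
  rw [← expect_addChar_sub, Finset.expect_mul, discreteFourier]
  simp only [diffAverage, Complex.ofReal_expect, Finset.expect_mul]
  rw [← Finset.expect_sum_comm]
  exact Finset.expect_congr rfl fun q _ => hshift _

theorem discreteFourier_iterate_diffAverage (X : Finset G) (g : G → ℝ) (k : ℕ)
    (γ : AddChar G ℂ) :
    discreteFourier ((diffAverage X)^[k] g) γ
      = ((‖muHat X γ‖ ^ 2) ^ k : ℝ) * discreteFourier g γ := by
  induction k with
  | zero => simp
  | succ k ih =>
    rw [Function.iterate_succ_apply', discreteFourier_diffAverage, ih, pow_succ' _ k,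
      Complex.ofReal_mul, mul_assoc]

theorem abs_iterate_diffAverage_translate_sub_le (X : Finset G) (g : G → ℝ) {κ : ℝ} {t : G}
    (hκ : 0 ≤ κ) (ht : ∀ γ : AddChar G ℂ, 1 / 2 ≤ ‖muHat X γ‖ → ‖γ t - 1‖ ≤ κ) (k : ℕ) (x : G) :
    |(diffAverage X)^[k] g (x + t) - (diffAverage X)^[k] g x|
      ≤ (𝔼 γ, ‖discreteFourier g γ‖) * (κ + 2 * (1 / 4) ^ k) := by
  rw [← Real.norm_eq_abs, ← Complex.norm_real, Complex.ofReal_sub, ← expect_discreteFourier_mul,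
    ← expect_discreteFourier_mul, ← Finset.expect_sub_distrib, Finset.expect_mul]
  refine (RCLike.norm_expect_le (K := ℂ)).trans (Finset.expect_le_expect fun γ _ => ?_)
  rw [discreteFourier_iterate_diffAverage, AddChar.map_add_eq_mul]
  calc ‖((‖muHat X γ‖ ^ 2) ^ k : ℝ) * discreteFourier g γ * (γ x * γ t)
        - ((‖muHat X γ‖ ^ 2) ^ k : ℝ) * discreteFourier g γ * γ x‖
      = ‖((‖muHat X γ‖ ^ 2) ^ k : ℝ) * discreteFourier g γ * γ x * (γ t - 1)‖ := by
        congr 1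
        ring
    _ = ‖discreteFourier g γ‖ * ((‖muHat X γ‖ ^ 2) ^ k * ‖γ t - 1‖) := by
        rw [norm_mul, norm_mul, norm_mul, Complex.norm_real, Real.norm_of_nonneg (by positivity),
          AddChar.norm_apply]
        ring
    _ ≤ ‖discreteFourier g γ‖ * (κ + 2 * (1 / 4) ^ k) := by
        gcongr
        exact norm_muHat_sq_pow_mul_norm_sub_one_le X hκ (ht γ) k

end AlmostPeriodicity

section Monotone

theorem sum_sub_le_of_disjoint_Icc {F : ℝ → ℝ} (hF : Monotone F) {ι : Type*} (I : Finset ι)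
    {c d : ι → ℝ} (hcd : ∀ i ∈ I, c i ≤ d i)
    (hI : (I : Set ι).PairwiseDisjoint fun i => Set.Icc (c i) (d i)) {a b : ℝ} (hab : a ≤ b)
    (ha : ∀ i ∈ I, a ≤ c i) (hb : ∀ i ∈ I, d i ≤ b) :
    ∑ i ∈ I, (F (d i) - F (c i)) ≤ F b - F a := by
  classical
  induction I using Finset.induction_on_max_value d generalizing b with
  | empty => simpa using hF hab
  | insert i I hi hmax ih =>
    have hlt : ∀ j ∈ I, d j ≤ c i := by
      intro j hj
      by_contra! hlt
      have hne : j ≠ i := fun h => hi (h ▸ hj)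
      have hdis := hI (Finset.mem_coe.mpr (Finset.mem_insert_of_mem hj))
        (Finset.mem_coe.mpr (Finset.mem_insert_self i I)) hne
      exact Set.disjoint_left.mp hdis
        (Set.right_mem_Icc.mpr (hcd j (Finset.mem_insert_of_mem hj))) ⟨hlt.le, hmax j hj⟩
    have hrest := ih (b := c i) (fun j hj => hcd j (Finset.mem_insert_of_mem hj))
      (hI.subset (by simp)) (ha i (Finset.mem_insert_self i I))
      (fun j hj => ha j (Finset.mem_insert_of_mem hj)) hlt
    have hlast := hF (hb i (Finset.mem_insert_self i I))
    rw [Finset.sum_insert hi]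
    linarith

theorem sub_le_of_forall_sum_radius_le {a b C R : ℝ} {x r : ℝ → ℝ}
    (hr : ∀ s ∈ Set.Icc a b, 0 < r s) (hR : ∀ s ∈ Set.Icc a b, r s ≤ R)
    (hmem : ∀ s ∈ Set.Icc a b, s ∈ Metric.closedBall (x s) (r s))
    (hsum : ∀ I : Finset ℝ, (I : Set ℝ) ⊆ Set.Icc a b →
      (I : Set ℝ).PairwiseDisjoint (fun s => Metric.closedBall (x s) (r s)) →
      ∑ s ∈ I, r s ≤ C) :
    b - a ≤ 8 * C := by
  classical
  have hC : 0 ≤ C := by simpa using hsum ∅ (by simp) (by simp)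
  obtain ⟨u, hu, hdis, hcov⟩ := Vitali.exists_disjoint_subfamily_covering_enlargement_closedBall
    (Set.Icc a b) x r R hR 4 (by norm_num)
  have hcount : u.Countable := hdis.countable_of_nonempty_interior fun s hs =>
    ⟨x s, Metric.ball_subset_interior_closedBall (Metric.mem_ball_self (hr s (hu hs)))⟩
  have hsub : Set.Icc a b ⊆ ⋃ s ∈ u, Metric.closedBall (x s) (4 * r s) := by
    intro s hs
    obtain ⟨s', hs', hss'⟩ := hcov s hs
    exact Set.mem_biUnion hs' (hss' (hmem s hs))
  have hfin : ∀ I : Finset u, ∑ s ∈ I, MeasureTheory.volume (Metric.closedBall (x s) (4 * r s))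
      ≤ ENNReal.ofReal (8 * C) := by
    intro I
    have hI : ((I.map (Function.Embedding.subtype _) : Finset ℝ) : Set ℝ) ⊆ u := by
      intro s hs
      obtain ⟨s, _, rfl⟩ := Finset.mem_map.mp (Finset.mem_coe.mp hs)
      exact s.2
    have hle := hsum _ (hI.trans hu) (hdis.subset hI)
    simp only [Finset.sum_map, Function.Embedding.subtype_apply] at hle
    simp only [Real.volume_closedBall]
    rw [← ENNReal.ofReal_sum_of_nonneg fun s _ => by linarith [hr s (hu s.2)], ← Finset.mul_sum,
      ← Finset.mul_sum]
    exact ENNReal.ofReal_le_ofReal (by linarith)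
  rw [← ENNReal.ofReal_le_ofReal_iff (by positivity), ← Real.volume_Icc]
  refine (MeasureTheory.measure_mono hsub).trans
    ((MeasureTheory.measure_biUnion_le _ hcount _).trans ?_)
  rw [ENNReal.tsum_eq_iSup_sum]
  exact iSup_le hfin

theorem abs_map_sub_eq_of_monotone {F : ℝ → ℝ} (hF : Monotone F) (s t : ℝ) :
    |F t - F s| = F ((s + t) / 2 + |t - s| / 2) - F ((s + t) / 2 - |t - s| / 2) := by
  rcases le_total s t with hst | hst
  · rw [abs_of_nonneg (sub_nonneg.mpr hst), abs_of_nonneg (sub_nonneg.mpr (hF hst))]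
    ring_nf
  · rw [abs_of_nonpos (sub_nonpos.mpr hst), abs_of_nonpos (sub_nonpos.mpr (hF hst))]
    ring_nf

/-- By Vitali's covering lemma, intervals on which `F` grows too fast cannot cover `[a, b]`. -/
theorem exists_abs_sub_le_of_monotone {F : ℝ → ℝ} (hF : Monotone F) {a b h₀ K : ℝ} (hab : a ≤ b)
    (hh : 0 ≤ h₀) (hK : 0 < K) (hinc : 4 * (F (b + h₀) - F (a - h₀)) < K * (b - a)) :
    ∃ s, a ≤ s ∧ s ≤ b ∧ ∀ h, |h| ≤ h₀ → |F (s + h) - F s| ≤ K * |h| := by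
  by_contra! hbad
  have hbad' : ∀ s ∈ Set.Icc a b, ∃ h, |h| ≤ h₀ ∧ K * |h| < |F (s + h) - F s| :=
    fun s hs => hbad s hs.1 hs.2
  choose! h hle hlt using hbad'
  let x : ℝ → ℝ := fun s => (s + (s + h s)) / 2
  let r : ℝ → ℝ := fun s => |s + h s - s| / 2
  have hr : ∀ s, r s = |h s| / 2 := fun s => by simp only [r, add_sub_cancel_left]
  have hx : ∀ s, x s = s + h s / 2 := fun s => by simp only [x]; ring
  have hcover : b - a ≤ 8 * ((F (b + h₀) - F (a - h₀)) / (2 * K)) := by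
    refine sub_le_of_forall_sum_radius_le (x := x) (r := r) (R := h₀ / 2) ?_ ?_ ?_ ?_
    · intro s hs
      have hne : h s ≠ 0 := fun h0 => by simpa [h0] using hlt s hs
      rw [hr]
      positivity
    · intro s hs
      linarith [hr s, hle s hs]
    · intro s _
      rw [Metric.mem_closedBall, Real.dist_eq, hr, hx, sub_add_cancel_left, abs_neg, abs_div,
        abs_two]
    · intro I hI hdis
      have hbound : ∀ s ∈ I, |h s| ≤ h₀ ∧ a ≤ s ∧ s ≤ b := fun s hs => ⟨hle s (hI hs), hI hs⟩
      have htotal := sum_sub_le_of_disjoint_Icc hF I (c := fun s => x s - r s)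
        (d := fun s => x s + r s) (fun s _ => by linarith [hr s, abs_nonneg (h s)])
        (by simpa only [Real.closedBall_eq_Icc] using hdis) (by linarith : a - h₀ ≤ b + h₀)
        (fun s hs => by linarith [hr s, hx s, neg_abs_le (h s), hbound s hs])
        (fun s hs => by linarith [hr s, hx s, le_abs_self (h s), hbound s hs])
      rw [le_div_iff₀ (by positivity), Finset.sum_mul]
      refine (Finset.sum_le_sum fun s hs => ?_).trans htotal
      rw [← abs_map_sub_eq_of_monotone hF, hr, div_mul_eq_mul_div, ← mul_assoc]
      linarith [hlt s (hI hs)]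
  rw [mul_div_assoc', le_div_iff₀ (by positivity)] at hcover
  linarith

end Monotone

section Characters

variable {G : Type*} [AddCommGroup G] [Finite G]

theorem norm_addChar_apply_neg_sub_one (γ : AddChar G ℂ) (x : G) :
    ‖γ (-x) - 1‖ = ‖γ x - 1‖ := by
  rw [AddChar.map_neg_eq_conj, ← Complex.norm_conj (γ x - 1), map_sub, map_one]

theorem norm_addChar_apply_add_sub_one_le (γ : AddChar G ℂ) (x y : G) :
    ‖γ (x + y) - 1‖ ≤ ‖γ x - 1‖ + ‖γ y - 1‖ := by
  have hsplit : γ (x + y) - 1 = (γ x - 1) * γ y + (γ y - 1) := by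
    rw [AddChar.map_add_eq_mul]; ring
  rw [hsplit]
  refine (norm_add_le _ _).trans ?_
  rw [norm_mul, AddChar.norm_apply, mul_one]

theorem norm_addChar_apply_sub_sub_one (γ : AddChar G ℂ) (x y : G) :
    ‖γ (x - y) - 1‖ = ‖γ x - γ y‖ := by
  have hfactor : γ x - γ y = (γ (x - y) - 1) * γ y := by
    rw [sub_mul, ← AddChar.map_add_eq_mul]; simp
  rw [hfactor, norm_mul, AddChar.norm_apply, mul_one]

theorem re_abs_im_bounds_of_norm_sub_one_le {z : ℂ} (hz : ‖z - 1‖ ≤ 1 / 2) :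
    1 / 2 ≤ z.re ∧ |z.im| ≤ 1 / 2 := by
  have hre := (Complex.abs_re_le_norm (z - 1)).trans hz
  have him := (Complex.abs_im_le_norm (z - 1)).trans hz
  simp only [Complex.sub_re, Complex.one_re, Complex.sub_im, Complex.one_im, sub_zero] at hre him
  exact ⟨by linarith [(abs_le.mp hre).1], him⟩

theorem norm_sub_le_two_mul_abs_im_sub {z w : ℂ} (hz : ‖z‖ = 1) (hw : ‖w‖ = 1)
    (hz1 : ‖z - 1‖ ≤ 1 / 2) (hw1 : ‖w - 1‖ ≤ 1 / 2) : ‖z - w‖ ≤ 2 * |z.im - w.im| := by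
  have hcircle : ∀ v : ℂ, ‖v‖ = 1 → v.re ^ 2 + v.im ^ 2 = 1 := by
    intro v hv
    have hsq := Complex.sq_norm v
    rw [hv, Complex.normSq_apply] at hsq
    linarith
  obtain ⟨hzre, hzim⟩ := re_abs_im_bounds_of_norm_sub_one_le hz1
  obtain ⟨hwre, hwim⟩ := re_abs_im_bounds_of_norm_sub_one_le hw1
  have hprod : |z.re - w.re| * (z.re + w.re) = |z.im - w.im| * |z.im + w.im| := by
    rw [← abs_of_nonneg (by linarith : 0 ≤ z.re + w.re), ← abs_mul, ← abs_mul, abs_eq_abs]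
    right
    linear_combination hcircle z hz - hcircle w hw
  have hsum : |z.im + w.im| ≤ 1 := (abs_add_le _ _).trans (by linarith)
  have hre : |z.re - w.re| ≤ |z.im - w.im| := calc
    |z.re - w.re| ≤ |z.re - w.re| * (z.re + w.re) :=
      le_mul_of_one_le_right (abs_nonneg _) (by linarith)
    _ ≤ |z.im - w.im| := hprod.trans_le (mul_le_of_le_one_right (abs_nonneg _) hsum)
  have hnorm := Complex.norm_le_abs_re_add_abs_im (z - w)
  rw [Complex.sub_re, Complex.sub_im] at hnorm
  linarith

theorem floor_mul_div_mem_Icc {r y : ℝ} (hr : 0 < r) (hy : |y| ≤ r) (N : ℕ) :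
    ⌊N * y / r⌋ ∈ Finset.Icc (-N : ℤ) N := by
  obtain ⟨hle, hge⟩ := abs_le.mp hy
  have : (0 : ℝ) ≤ N := N.cast_nonneg
  rw [Finset.mem_Icc]
  constructor
  · rw [Int.le_floor, le_div_iff₀ hr]
    push_cast
    nlinarith
  · refine Int.cast_le.mp ((Int.floor_le (N * y / r)).trans ?_)
    rw [div_le_iff₀ hr]
    push_cast
    nlinarith

theorem abs_sub_mul_le_of_floor_eq {r y z : ℝ} (hr : 0 < r) {N : ℕ}
    (h : ⌊N * y / r⌋ = ⌊N * z / r⌋) : N * |y - z| ≤ r := by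
  have hlt := Int.abs_sub_lt_one_of_floor_eq_floor h
  rw [← sub_div, ← mul_sub, abs_div, abs_mul, Nat.abs_cast, abs_of_pos hr, div_lt_one hr] at hlt
  exact hlt.le

end Characters

namespace BohrSet

variable {G : Type*} [AddCommGroup G] [Fintype G]

theorem mem_carrier {B : BohrSet G} {x : G} :
    x ∈ B.carrier ↔ ∀ γ ∈ B.freq, ‖γ x - 1‖ ≤ (B.radius : ℝ) := by
  simp [carrier]

theorem carrier_nonempty (B : BohrSet G) : B.carrier.Nonempty :=
  ⟨0, mem_carrier.mpr fun γ _ => by simp⟩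

theorem card_carrier_pos (B : BohrSet G) : (0 : ℝ) < B.carrier.card := by
  exact_mod_cast B.carrier_nonempty.card_pos

theorem neg_mem_carrier {B : BohrSet G} {x : G} (hx : x ∈ B.carrier) : -x ∈ B.carrier := by
  rw [mem_carrier] at hx ⊢
  intro γ hγ
  rw [norm_addChar_apply_neg_sub_one]
  exact hx γ hγ

theorem carrier_subset {Γ Λ : Finset (AddChar G ℂ)} {r s : ℝ≥0} (h : Γ ⊆ Λ) (hrs : r ≤ s) :
    (⟨Λ, r⟩ : BohrSet G).carrier ⊆ (⟨Γ, s⟩ : BohrSet G).carrier := by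
  intro x hx
  rw [mem_carrier] at hx ⊢
  exact fun γ hγ => (hx γ (h hγ)).trans (by exact_mod_cast hrs)

theorem add_mem_carrier {Γ : Finset (AddChar G ℂ)} {r s t : ℝ≥0} {x y : G}
    (hx : x ∈ (⟨Γ, r⟩ : BohrSet G).carrier) (hy : y ∈ (⟨Γ, s⟩ : BohrSet G).carrier)
    (h : r + s ≤ t) : x + y ∈ (⟨Γ, t⟩ : BohrSet G).carrier := by
  rw [mem_carrier] at hx hy ⊢
  intro γ hγ
  have hrst : (r : ℝ) + s ≤ t := by exact_mod_cast h
  exact (norm_addChar_apply_add_sub_one_le γ x y).trans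
    ((add_le_add (hx γ hγ) (hy γ hγ)).trans hrst)

theorem sub_mem_carrier_of_floor_eq {Γ : Finset (AddChar G ℂ)} {r s : ℝ≥0} {N : ℕ} (hr : 0 < r)
    (hr2 : (r : ℝ) ≤ 1 / 2) (hN : 0 < N) (hrs : 2 * (r : ℝ) ≤ N * s) {x y : G}
    (hx : x ∈ (⟨Γ, r⟩ : BohrSet G).carrier) (hy : y ∈ (⟨Γ, r⟩ : BohrSet G).carrier)
    (h : ∀ γ ∈ Γ, ⌊N * (γ x).im / r⌋ = ⌊N * (γ y).im / r⌋) :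
    x - y ∈ (⟨Γ, s⟩ : BohrSet G).carrier := by
  rw [mem_carrier] at hx hy ⊢
  intro γ hγ
  have him := abs_sub_mul_le_of_floor_eq (NNReal.coe_pos.mpr hr) (h γ hγ)
  rw [norm_addChar_apply_sub_sub_one]
  refine (norm_sub_le_two_mul_abs_im_sub (AddChar.norm_apply _ _) (AddChar.norm_apply _ _)
    ((hx γ hγ).trans hr2) ((hy γ hγ).trans hr2)).trans ?_
  exact le_of_mul_le_mul_left (by linarith) (Nat.cast_pos.mpr hN : (0 : ℝ) < N)

theorem card_carrier_le_mul_pow (Γ : Finset (AddChar G ℂ)) {r s : ℝ≥0} {N : ℕ} (hr : 0 < r)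
    (hr2 : (r : ℝ) ≤ 1 / 2) (hN : 0 < N) (hrs : 2 * (r : ℝ) ≤ N * s) :
    (⟨Γ, r⟩ : BohrSet G).carrier.card
      ≤ (⟨Γ, s⟩ : BohrSet G).carrier.card * (2 * N + 1) ^ Γ.card := by
  classical
  let cell : G → (Γ → ℤ) := fun x γ => ⌊N * (γ.1 x).im / r⌋
  let box : Finset (Γ → ℤ) := Fintype.piFinset fun _ => Finset.Icc (-N : ℤ) N
  have hbox : box.card = (2 * N + 1) ^ Γ.card := by
    simp only [box, Fintype.card_piFinset, Int.card_Icc, Finset.prod_const, Finset.card_univ,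
      Fintype.card_coe]
    congr 1
    omega
  rw [← hbox]
  refine Finset.card_le_mul_card_image_of_maps_to (f := cell) ?_ _ ?_
  · intro x hx
    refine Fintype.mem_piFinset.mpr fun γ => floor_mul_div_mem_Icc (NNReal.coe_pos.mpr hr) ?_ N
    simpa using (Complex.abs_im_le_norm (γ.1 x - 1)).trans (mem_carrier.mp hx γ.1 γ.2)
  · intro c _
    rcases Finset.eq_empty_or_nonempty
      (((⟨Γ, r⟩ : BohrSet G).carrier).filter fun x => cell x = c) with hempty | ⟨y, hy⟩
    · rw [hempty]; simp
    · obtain ⟨hyr, hyc⟩ := Finset.mem_filter.mp hy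
      refine Finset.card_le_card_of_injOn (fun x => x - y) ?_ (sub_left_injective.injOn)
      intro x hx
      obtain ⟨hxr, hxc⟩ := Finset.mem_filter.mp (Finset.mem_coe.mp hx)
      exact sub_mem_carrier_of_floor_eq hr hr2 hN hrs hxr hyr
        fun γ hγ => congrFun (hxc.trans hyc.symm) ⟨γ, hγ⟩

end BohrSet

section Exponential

theorem abs_log_one_add_le {τ : ℝ} (hτ : |τ| ≤ 1 / 12) : |Real.log (1 + τ)| ≤ 12 / 11 * |τ| := by
  have hpos : 0 < 1 + τ := by linarith [neg_abs_le τ]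
  have hupper := Real.log_le_sub_one_of_pos hpos
  have hlower := Real.one_sub_inv_le_log_of_pos hpos
  have hinv : 1 - (1 + τ)⁻¹ = τ / (1 + τ) := by field_simp; ring
  have hquot : -(12 / 11 * |τ|) ≤ τ / (1 + τ) := by
    rw [le_div_iff₀ hpos]
    nlinarith [neg_abs_le τ, abs_nonneg τ]
  exact abs_le.mpr ⟨by linarith, by linarith [le_abs_self τ, abs_nonneg τ]⟩

theorem abs_exp_sub_one_le_of_abs_le {y u : ℝ} (hy : |y| ≤ 78 / 11 * u) (hu : 12 * u ≤ 1) :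
    |Real.exp y - 1| ≤ 12 * u := by
  have hquad := Real.abs_exp_sub_one_sub_id_le (x := y) (by linarith)
  rw [← sq_abs y] at hquad
  have htri : |Real.exp y - 1| ≤ |Real.exp y - 1 - y| + |y| := by
    simpa using abs_add_le (Real.exp y - 1 - y) y
  nlinarith [abs_nonneg y]

end Exponential

namespace BohrSet

variable {G : Type*} [AddCommGroup G] [Fintype G]

/-- The logarithm of the size of the Bohr set with frequencies `Γ` and radius `exp s`; its local
Lipschitz behaviour in `s` governs regularity. -/
noncomputable def logCard (Γ : Finset (AddChar G ℂ)) (s : ℝ) : ℝ :=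
  Real.log (⟨Γ, (Real.exp s).toNNReal⟩ : BohrSet G).carrier.card

theorem logCard_mono (Γ : Finset (AddChar G ℂ)) : Monotone (logCard Γ) := by
  intro s t hst
  refine Real.log_le_log (card_carrier_pos _) ?_
  exact_mod_cast Finset.card_le_card (carrier_subset subset_rfl
    (Real.toNNReal_le_toNNReal (Real.exp_le_exp.mpr hst)))

theorem logCard_add_five_le (Γ : Finset (AddChar G ℂ)) {s : ℝ} (hs : Real.exp (s + 5) ≤ 1 / 2) :
    logCard Γ (s + 5) ≤ logCard Γ s + Γ.card * Real.log 601 := by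
  have hexp : ∀ t, (((Real.exp t).toNNReal : ℝ≥0) : ℝ) = Real.exp t := fun t =>
    Real.coe_toNNReal _ (Real.exp_pos _).le
  have hexp5 : Real.exp 5 ≤ 150 := by
    rw [show (5 : ℝ) = (5 : ℕ) * 1 by norm_num, Real.exp_nat_mul]
    calc Real.exp 1 ^ 5 ≤ 2.7182818286 ^ 5 :=
          pow_le_pow_left₀ (Real.exp_pos 1).le Real.exp_one_lt_d9.le 5
      _ ≤ 150 := by norm_num
  have hcard := card_carrier_le_mul_pow Γ (r := (Real.exp (s + 5)).toNNReal)
    (s := (Real.exp s).toNNReal) (N := 300) (Real.toNNReal_pos.mpr (Real.exp_pos _))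
    (by rwa [hexp]) (by norm_num) (by
      rw [hexp, hexp, Real.exp_add]
      push_cast
      nlinarith [Real.exp_pos s])
  rw [logCard, logCard, ← Real.log_pow, ← Real.log_mul (card_carrier_pos _).ne' (by positivity)]
  exact Real.log_le_log (card_carrier_pos _) (by exact_mod_cast hcard)

theorem isRegular_of_radius_eq_zero (Γ : Finset (AddChar G ℂ)) :
    (⟨Γ, 0⟩ : BohrSet G).IsRegular := by
  intro τ _
  have hdilate : (⟨Γ, 0⟩ : BohrSet G).dilate (1 + τ).toNNReal = ⟨Γ, 0⟩ := by simp [dilate]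
  rw [hdilate, div_self (card_carrier_pos _).ne']
  have : 0 ≤ 12 * ((⟨Γ, 0⟩ : BohrSet G).rank : ℝ) * |τ| := by positivity
  constructor <;> linarith

theorem isRegular_of_abs_logCard_sub_le {Γ : Finset (AddChar G ℂ)} (hΓ : Γ.Nonempty) {s : ℝ}
    (h : ∀ h, |h| ≤ 1 / 2 → |logCard Γ (s + h) - logCard Γ s| ≤ 13 / 2 * Γ.card * |h|) :
    (⟨Γ, (Real.exp s).toNNReal⟩ : BohrSet G).IsRegular := by
  intro τ hτ
  simp only [rank] at hτ ⊢
  have hd : (1 : ℝ) ≤ Γ.card := by exact_mod_cast hΓ.card_pos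
  rw [le_div_iff₀ (by positivity)] at hτ
  have hτ1 : |τ| ≤ 1 / 12 := by nlinarith [abs_nonneg τ]
  have hpos : 0 < 1 + τ := by linarith [(abs_le.mp hτ1).1]
  have hdilate : (⟨Γ, (Real.exp s).toNNReal⟩ : BohrSet G).dilate (1 + τ).toNNReal
      = ⟨Γ, (Real.exp (s + Real.log (1 + τ))).toNNReal⟩ := by
    simp only [dilate]
    congr 1
    rw [Real.exp_add, Real.exp_log hpos, mul_comm, Real.toNNReal_mul (Real.exp_pos _).le]
  have hlog := abs_log_one_add_le hτ1
  have hratio := abs_exp_sub_one_le_of_abs_le (u := Γ.card * |τ|)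
    (y := logCard Γ (s + Real.log (1 + τ)) - logCard Γ s)
    ((h _ (by linarith)).trans (by nlinarith)) (by linarith)
  rw [Real.exp_sub, logCard, logCard, Real.exp_log (card_carrier_pos _),
    Real.exp_log (card_carrier_pos _), ← hdilate, abs_le] at hratio
  constructor <;> linarith [hratio.1, hratio.2]

theorem log_601_lt : Real.log 601 < 13 / 2 := by
  have hsq : (601 : ℝ) ^ 2 < Real.exp 13 := by
    rw [show (13 : ℝ) = (13 : ℕ) * 1 by norm_num, Real.exp_nat_mul]
    calc (601 : ℝ) ^ 2 < 2.7182818283 ^ 13 := by norm_num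
      _ ≤ Real.exp 1 ^ 13 := pow_le_pow_left₀ (by norm_num) Real.exp_one_gt_d9.le 13
  have hlog := (Real.log_lt_iff_lt_exp (by norm_num)).mpr hsq
  rw [Real.log_pow] at hlog
  push_cast at hlog
  linarith

theorem exists_isRegular_exp {Γ : Finset (AddChar G ℂ)} (hΓ : Γ.Nonempty) {b : ℝ}
    (hb : Real.exp b ≤ 1 / 4) :
    ∃ s, b - 4 ≤ s ∧ s ≤ b ∧ (⟨Γ, (Real.exp s).toNNReal⟩ : BohrSet G).IsRegular := by
  have hd : (0 : ℝ) < Γ.card := by exact_mod_cast hΓ.card_pos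
  have hhalf : Real.exp (1 / 2) ≤ 2 := by
    have hsq : Real.exp (1 / 2) ^ 2 = Real.exp 1 := by rw [← Real.exp_nat_mul]; norm_num
    nlinarith [Real.exp_one_lt_d9, Real.exp_pos (1 / 2)]
  have hgrowth := logCard_add_five_le Γ (s := b - 4 - 1 / 2) (by
    rw [show b - 4 - 1 / 2 + 5 = b + 1 / 2 by ring, Real.exp_add]
    nlinarith [Real.exp_pos b])
  rw [show b - 4 - 1 / 2 + 5 = b + 1 / 2 by ring] at hgrowth
  have hlog := mul_lt_mul_of_pos_left log_601_lt hd
  obtain ⟨s, hs, hsb, hlip⟩ := exists_abs_sub_le_of_monotone (logCard_mono Γ)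
    (a := b - 4) (b := b) (h₀ := 1 / 2) (K := 13 / 2 * Γ.card) (by linarith) (by norm_num)
    (by positivity) (by linarith)
  exact ⟨s, hs, hsb, isRegular_of_abs_logCard_sub_le hΓ hlip⟩

theorem exists_isRegular {Γ : Finset (AddChar G ℂ)} (hΓ : Γ.Nonempty) {R : ℝ≥0}
    (hR : (R : ℝ) ≤ 1 / 4) :
    ∃ R' : ℝ≥0, (R : ℝ) / 81 ≤ R' ∧ R' ≤ R ∧ (⟨Γ, R'⟩ : BohrSet G).IsRegular := by
  rcases eq_or_ne R 0 with rfl | hR0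
  · exact ⟨0, by simp, le_rfl, isRegular_of_radius_eq_zero Γ⟩
  have hpos : (0 : ℝ) < R := by exact_mod_cast pos_iff_ne_zero.mpr hR0
  obtain ⟨s, hs, hsR, hreg⟩ := exists_isRegular_exp hΓ (b := Real.log R)
    (by rwa [Real.exp_log hpos])
  have hexp : (((Real.exp s).toNNReal : ℝ≥0) : ℝ) = Real.exp s :=
    Real.coe_toNNReal _ (Real.exp_pos _).le
  refine ⟨(Real.exp s).toNNReal, ?_, ?_, hreg⟩
  · have hexp4 : Real.exp 4 ≤ 81 := by
      rw [show (4 : ℝ) = (4 : ℕ) * 1 by norm_num, Real.exp_nat_mul]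
      calc Real.exp 1 ^ 4 ≤ 3 ^ 4 :=
            pow_le_pow_left₀ (Real.exp_pos 1).le (by linarith [Real.exp_one_lt_d9]) 4
        _ = 81 := by norm_num
    rw [hexp]
    calc (R : ℝ) / 81 ≤ R / Real.exp 4 := by gcongr
      _ = Real.exp (Real.log R - 4) := by rw [Real.exp_sub, Real.exp_log hpos]
      _ ≤ Real.exp s := Real.exp_le_exp.mpr hs
  · rw [← NNReal.coe_le_coe, hexp, ← Real.exp_log hpos]
    exact Real.exp_le_exp.mpr hsR

end BohrSet

section FourierMeasure

variable {G : Type*} [AddCommGroup G] [Fintype G]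

theorem discreteFourier_one (u : G → ℝ) : discreteFourier u 1 = ((∑ x, u x : ℝ) : ℂ) := by
  simp [discreteFourier]

theorem norm_discreteFourier_indFun_le (W : Finset G) (γ : AddChar G ℂ) :
    ‖discreteFourier (indFun W) γ‖ ≤ W.card := by
  have hterm : ∀ x, ‖(indFun W x : ℂ) * γ (-x)‖ = indFun W x * 1 := by
    intro x
    rw [norm_mul, AddChar.norm_apply, Complex.norm_real, Real.norm_of_nonneg (indFun_nonneg W x)]
  refine (norm_sum_le _ _).trans_eq ?_
  simp only [hterm]
  rw [sum_indFun_mul]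
  simp

theorem norm_discreteFourier_muFun (X : Finset G) (γ : AddChar G ℂ) :
    ‖discreteFourier (muFun X) γ‖ = ‖muHat X γ‖ := by
  rw [← Complex.norm_conj (muHat X γ), ← expect_addChar_neg, Finset.expect_eq_sum_div_card,
    discreteFourier]
  congr 1
  classical
  rw [← Finset.sum_subset (Finset.subset_univ X), Finset.sum_div]
  · refine Finset.sum_congr rfl fun x hx => ?_
    rw [muFun, indFun_of_mem hx]
    push_cast
    ring
  · intro x _ hx
    rw [muFun, indFun_of_notMem hx, zero_div, Complex.ofReal_zero, zero_mul]

theorem norm_discreteFourier_iterate_conv_muFun (V : Finset G) (u : G → ℝ) (l : ℕ)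
    (γ : AddChar G ℂ) :
    ‖discreteFourier ((conv (muFun V))^[l] u) γ‖ = ‖muHat V γ‖ ^ l * ‖discreteFourier u γ‖ := by
  induction l with
  | zero => simp
  | succ l ih =>
    rw [Function.iterate_succ_apply', discreteFourier_conv, norm_mul, ih,
      norm_discreteFourier_muFun, pow_succ', mul_assoc]

theorem norm_discreteFourier_iterate_conv_muFun_indFun_le (V W : Finset G) (l : ℕ)
    (γ : AddChar G ℂ) :
    ‖discreteFourier ((conv (muFun V))^[l] (indFun W)) γ‖ ≤ ‖muHat V γ‖ ^ l * W.card := by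
  rw [norm_discreteFourier_iterate_conv_muFun]
  exact mul_le_mul_of_nonneg_left (norm_discreteFourier_indFun_le W γ) (by positivity)

theorem iterate_conv_muFun_nonneg (V : Finset G) {u : G → ℝ} (hu : ∀ x, 0 ≤ u x) (l : ℕ) (x : G) :
    0 ≤ (conv (muFun V))^[l] u x := by
  induction l generalizing x with
  | zero => exact hu x
  | succ l ih =>
    rw [Function.iterate_succ_apply']
    exact conv_muFun_nonneg V ih x

theorem sum_iterate_conv_muFun_indFun_le (V W : Finset G) (l : ℕ) :
    ∑ x, (conv (muFun V))^[l] (indFun W) x ≤ W.card := by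
  have hnorm := norm_discreteFourier_iterate_conv_muFun_indFun_le V W l 1
  rw [discreteFourier_one, Complex.norm_real] at hnorm
  refine (Real.le_norm_self _).trans (hnorm.trans ?_)
  exact mul_le_of_le_one_left (Nat.cast_nonneg _)
    (pow_le_one₀ (norm_nonneg _) (norm_muHat_le_one V 1))

theorem BohrSet.iterate_conv_muFun_indFun_eq_one {Γ : Finset (AddChar G ℂ)} {r : ℝ≥0} (l : ℕ)
    {s s' : ℝ≥0} (hs : s' + l * r ≤ s) {x : G} (hx : x ∈ (⟨Γ, s'⟩ : BohrSet G).carrier) :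
    (conv (muFun (⟨Γ, r⟩ : BohrSet G).carrier))^[l] (indFun (⟨Γ, s⟩ : BohrSet G).carrier) x
      = 1 := by
  induction l generalizing x s' with
  | zero =>
    simp only [Nat.cast_zero, zero_mul, add_zero] at hs
    exact indFun_of_mem (carrier_subset subset_rfl hs hx)
  | succ l ih =>
    rw [Function.iterate_succ_apply', conv_muFun_left]
    refine (Finset.expect_congr rfl fun v hv => ih (s' := s' + r) ?_ ?_).trans
      (Finset.expect_const (carrier_nonempty _) 1)
    · refine le_trans (le_of_eq ?_) hs
      push_cast; ring
    · rw [sub_eq_add_neg]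
      exact add_mem_carrier hx (neg_mem_carrier hv) le_rfl

end FourierMeasure

section RieszProduct

variable {G : Type*} [AddCommGroup G]

/-- The Riesz product `∏ (1 + a Re(c(χ) χ(-x)))` over the characters in `Λ`. -/
noncomputable def rieszProduct (a : ℝ) (c : AddChar G ℂ → ℂ) (Λ : Finset (AddChar G ℂ)) (x : G) :
    ℝ :=
  ∏ χ ∈ Λ, (1 + a * (c χ * χ (-x)).re)

theorem prod_insert_zpow_update [DecidableEq (AddChar G ℂ)] {γ : AddChar G ℂ}
    {Λ : Finset (AddChar G ℂ)} (hγ : γ ∉ Λ) (m : AddChar G ℂ → ℤ) (j : ℤ) :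
    ∏ χ ∈ insert γ Λ, χ ^ (Function.update m γ j χ) = γ ^ j * ∏ χ ∈ Λ, χ ^ m χ := by
  rw [Finset.prod_insert hγ, Function.update_self]
  congr 1
  refine Finset.prod_congr rfl fun χ hχ => ?_
  rw [Function.update_of_ne]
  rintro rfl
  exact hγ hχ

theorem abs_update_le_one [DecidableEq (AddChar G ℂ)] {m : AddChar G ℂ → ℤ}
    (hm : ∀ χ, |m χ| ≤ 1) (γ : AddChar G ℂ) {j : ℤ} (hj : |j| ≤ 1) (χ : AddChar G ℂ) :
    |Function.update m γ j χ| ≤ 1 := by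
  rcases eq_or_ne χ γ with rfl | hne
  · rwa [Function.update_self]
  · rw [Function.update_of_ne hne]
    exact hm χ

variable [Fintype G]

theorem discreteFourier_mul_rieszProduct_insert [DecidableEq (AddChar G ℂ)] (u : G → ℝ) (a : ℝ)
    (c : AddChar G ℂ → ℂ) {γ : AddChar G ℂ} {Λ : Finset (AddChar G ℂ)} (hγ : γ ∉ Λ)
    (ψ : AddChar G ℂ) :
    discreteFourier (u * rieszProduct a c (insert γ Λ)) ψ
      = discreteFourier (u * rieszProduct a c Λ) ψ
        + a / 2 * (c γ * discreteFourier (u * rieszProduct a c Λ) (ψ * γ)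
          + (starRingEnd ℂ) (c γ) * discreteFourier (u * rieszProduct a c Λ) (ψ * γ⁻¹)) := by
  simp only [discreteFourier, Finset.mul_sum, mul_add, ← Finset.sum_add_distrib]
  refine Finset.sum_congr rfl fun x _ => ?_
  have hre : ((c γ * γ (-x)).re : ℂ)
      = (c γ * γ (-x) + (starRingEnd ℂ) (c γ) * γ⁻¹ (-x)) / 2 := by
    rw [Complex.re_eq_add_conj, map_mul, ← AddChar.map_neg_eq_conj, AddChar.inv_apply]
  simp only [Pi.mul_apply, rieszProduct, Finset.prod_insert hγ, AddChar.mul_apply]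
  push_cast
  rw [hre]
  ring

theorem norm_half_mul_add_conj_mul_le {a : ℝ} (ha : 0 ≤ a) {c u v : ℂ} (hc : ‖c‖ ≤ 1) {D : ℝ}
    (hu : ‖u‖ ≤ D) (hv : ‖v‖ ≤ D) : ‖a / 2 * (c * u + (starRingEnd ℂ) c * v)‖ ≤ a * D := by
  have : 0 ≤ D := (norm_nonneg _).trans hu
  rw [norm_mul, norm_div, Complex.norm_real, Real.norm_of_nonneg ha, Complex.norm_two]
  calc a / 2 * ‖c * u + (starRingEnd ℂ) c * v‖ ≤ a / 2 * (1 * D + 1 * D) := by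
        gcongr
        refine (norm_add_le _ _).trans ?_
        rw [norm_mul, norm_mul, Complex.norm_conj]
        gcongr
    _ = a * D := by ring

theorem norm_discreteFourier_mul_rieszProduct_le {u : G → ℝ} {a : ℝ} (ha : 0 ≤ a)
    {c : AddChar G ℂ → ℂ} (hc : ∀ γ, ‖c γ‖ ≤ 1) {κ : ℝ} (Λ : Finset (AddChar G ℂ))
    (ψ : AddChar G ℂ)
    (h : ∀ m : AddChar G ℂ → ℤ, (∀ χ, |m χ| ≤ 1) →
      ‖discreteFourier u (ψ * ∏ χ ∈ Λ, χ ^ m χ)‖ ≤ κ) :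
    ‖discreteFourier (u * rieszProduct a c Λ) ψ‖ ≤ κ * (1 + a) ^ Λ.card := by
  classical
  induction Λ using Finset.induction_on generalizing ψ with
  | empty => simpa [rieszProduct, discreteFourier] using h 0 (by simp)
  | insert γ Λ hγ ih =>
    have hcoeff : ∀ j : ℤ, |j| ≤ 1 →
        ‖discreteFourier (u * rieszProduct a c Λ) (ψ * γ ^ j)‖ ≤ κ * (1 + a) ^ Λ.card := by
      intro j hj
      refine ih _ fun m hm => ?_
      have hm' := h (Function.update m γ j) (abs_update_le_one hm γ hj)
      rwa [prod_insert_zpow_update hγ, ← mul_assoc] at hm'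
    have hzero := hcoeff 0 (by simp)
    have hone := hcoeff 1 (by simp)
    have hneg := hcoeff (-1) (by simp)
    rw [zpow_zero, mul_one] at hzero
    rw [zpow_one] at hone
    rw [zpow_neg_one] at hneg
    have hrest := norm_half_mul_add_conj_mul_le ha (hc γ) hone hneg
    rw [discreteFourier_mul_rieszProduct_insert u a c hγ, Finset.card_insert_of_notMem hγ,
      pow_succ]
    refine (norm_add_le _ _).trans ?_
    linarith

theorem norm_discreteFourier_mul_rieszProduct_one_sub_le {u : G → ℝ} {a : ℝ} (ha : 0 ≤ a)
    {c : AddChar G ℂ → ℂ} (hc : ∀ γ, ‖c γ‖ ≤ 1) {κ : ℝ} (Λ : Finset (AddChar G ℂ))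
    (h : ∀ m : AddChar G ℂ → ℤ, (∀ χ, |m χ| ≤ 1) → (∃ χ ∈ Λ, m χ ≠ 0) →
      ‖discreteFourier u (∏ χ ∈ Λ, χ ^ m χ)‖ ≤ κ) :
    ‖discreteFourier (u * rieszProduct a c Λ) 1 - discreteFourier u 1‖
      ≤ κ * ((1 + a) ^ Λ.card - 1) := by
  classical
  induction Λ using Finset.induction_on with
  | empty => simp [rieszProduct, discreteFourier]
  | insert γ Λ hγ ih =>
    have hcoeff : ∀ j : ℤ, |j| ≤ 1 → j ≠ 0 →
        ‖discreteFourier (u * rieszProduct a c Λ) (γ ^ j)‖ ≤ κ * (1 + a) ^ Λ.card := by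
      intro j hj hj0
      refine norm_discreteFourier_mul_rieszProduct_le ha hc Λ _ fun m hm => ?_
      have hm' := h (Function.update m γ j) (abs_update_le_one hm γ hj)
        ⟨γ, Finset.mem_insert_self _ _, by rwa [Function.update_self]⟩
      rwa [prod_insert_zpow_update hγ] at hm'
    have hmain := ih fun m hm ⟨χ, hχ, hχ0⟩ => by
      have hne : χ ≠ γ := fun h => hγ (h ▸ hχ)
      have hm' := h (Function.update m γ 0) (abs_update_le_one hm γ (by simp))
        ⟨χ, Finset.mem_insert_of_mem hχ, by rwa [Function.update_of_ne hne]⟩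
      rwa [prod_insert_zpow_update hγ, zpow_zero, one_mul] at hm'
    have hone := hcoeff 1 (by simp) (by simp)
    have hneg := hcoeff (-1) (by simp) (by simp)
    rw [zpow_one] at hone
    rw [zpow_neg_one] at hneg
    have hrest := norm_half_mul_add_conj_mul_le ha (hc γ) hone hneg
    rw [discreteFourier_mul_rieszProduct_insert u a c hγ, one_mul, one_mul, add_sub_right_comm,
      Finset.card_insert_of_notMem hγ, pow_succ]
    refine (norm_add_le _ _).trans ?_
    linarith

end RieszProduct

section Dissociated

variable {G : Type*} [AddCommGroup G]

/-- `Λ` is dissociated relative to `V` if no nontrivial `{-1, 0, 1}`-combination of its elements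
lies in the large spectrum of `V`. -/
def IsDissociatedRel (V : Finset G) (Λ : Finset (AddChar G ℂ)) : Prop :=
  ∀ m : AddChar G ℂ → ℤ, (∀ χ, |m χ| ≤ 1) → (∃ χ ∈ Λ, m χ ≠ 0) →
    ‖muHat V (∏ χ ∈ Λ, χ ^ m χ)‖ ≤ 1 / 2

theorem IsDissociatedRel.subset {V : Finset G} {Λ Λ' : Finset (AddChar G ℂ)}
    (h : IsDissociatedRel V Λ) (hs : Λ' ⊆ Λ) : IsDissociatedRel V Λ' := by
  classical
  intro m hm ⟨χ, hχ, hχ0⟩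
  have hbound := h (fun χ => if χ ∈ Λ' then m χ else 0)
    (fun χ => by by_cases hc : χ ∈ Λ' <;> simp [hc, hm χ]) ⟨χ, hs hχ, by simpa [hχ] using hχ0⟩
  have hprod : ∏ χ ∈ Λ, χ ^ (if χ ∈ Λ' then m χ else 0) = ∏ χ ∈ Λ', χ ^ m χ := by
    rw [← Finset.prod_subset hs]
    · exact Finset.prod_congr rfl fun χ hχ => by rw [if_pos hχ]
    · intro χ _ hχ
      rw [if_neg hχ, zpow_zero]
  rwa [hprod] at hbound

theorem exists_maximal_isDissociatedRel (V : Finset G) (Δ : Finset (AddChar G ℂ)) :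
    ∃ Λ, Maximal (fun Λ => Λ ⊆ Δ ∧ IsDissociatedRel V Λ) Λ := by
  classical
  obtain ⟨Λ, -, hΛ⟩ := (Δ.powerset.filter (IsDissociatedRel V)).exists_le_maximal (a := ∅)
    (by simp [IsDissociatedRel])
  exact ⟨Λ, by simpa only [Finset.mem_filter, Finset.mem_powerset] using hΛ⟩

variable [Finite G]

theorem norm_zpow_apply_sub_one {γ : AddChar G ℂ} {j : ℤ} (hj : |j| ≤ 1) (hj0 : j ≠ 0) (t : G) :
    ‖(γ ^ j) t - 1‖ = ‖γ t - 1‖ := by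
  have hunit : j = 1 ∨ j = -1 := by rw [abs_le] at hj; omega
  rcases hunit with rfl | rfl
  · rw [zpow_one]
  · rw [zpow_neg_one, AddChar.inv_apply, norm_addChar_apply_neg_sub_one]

theorem norm_mul_apply_sub_one_le (γ ψ : AddChar G ℂ) (t : G) :
    ‖(γ * ψ) t - 1‖ ≤ ‖γ t - 1‖ + ‖ψ t - 1‖ := by
  have hsplit : (γ * ψ) t - 1 = (γ t - 1) * ψ t + (ψ t - 1) := by
    rw [AddChar.mul_apply]; ring
  rw [hsplit]
  refine (norm_add_le _ _).trans ?_
  rw [norm_mul, AddChar.norm_apply, mul_one]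

theorem norm_prod_zpow_apply_sub_one_le {m : AddChar G ℂ → ℤ} (hm : ∀ χ, |m χ| ≤ 1)
    (Λ : Finset (AddChar G ℂ)) (t : G) :
    ‖(∏ χ ∈ Λ, χ ^ m χ) t - 1‖ ≤ ∑ χ ∈ Λ, ‖χ t - 1‖ := by
  classical
  induction Λ using Finset.induction_on with
  | empty => simp
  | insert γ Λ hγ ih =>
    have hpow : ‖(γ ^ m γ) t - 1‖ ≤ ‖γ t - 1‖ := by
      rcases eq_or_ne (m γ) 0 with h0 | h0
      · rw [h0]; simp
      · exact (norm_zpow_apply_sub_one (hm γ) h0 t).le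
    rw [Finset.prod_insert hγ, Finset.sum_insert hγ]
    exact (norm_mul_apply_sub_one_le _ _ t).trans (add_le_add hpow ih)

theorem norm_apply_sub_one_le_of_not_isDissociatedRel_insert [DecidableEq (AddChar G ℂ)]
    {V : Finset G} {Λ : Finset (AddChar G ℂ)} (hΛ : IsDissociatedRel V Λ) {γ : AddChar G ℂ}
    (hγ : γ ∉ Λ) (hnot : ¬ IsDissociatedRel V (insert γ Λ)) {t : G} {κ : ℝ}
    (ht : ∀ χ : AddChar G ℂ, 1 / 2 ≤ ‖muHat V χ‖ → ‖χ t - 1‖ ≤ κ) :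
    ‖γ t - 1‖ ≤ κ + ∑ χ ∈ Λ, ‖χ t - 1‖ := by
  simp only [IsDissociatedRel, not_forall, not_le] at hnot
  obtain ⟨m, hm, ⟨χ, hχ, hχ0⟩, hbig⟩ := hnot
  have hmγ : m γ ≠ 0 := by
    intro h0
    rw [Finset.prod_insert hγ, h0, zpow_zero, one_mul] at hbig
    refine hbig.not_ge (hΛ m hm ⟨χ, ?_, hχ0⟩)
    exact (Finset.mem_insert.mp hχ).resolve_left fun h => hχ0 (h ▸ h0)
  have hsolve : γ ^ m γ = (∏ χ ∈ insert γ Λ, χ ^ m χ) * (∏ χ ∈ Λ, χ ^ m χ)⁻¹ := by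
    rw [Finset.prod_insert hγ, mul_inv_cancel_right]
  rw [← norm_zpow_apply_sub_one (hm γ) hmγ, hsolve]
  refine (norm_mul_apply_sub_one_le _ _ t).trans (add_le_add (ht _ hbig.le) ?_)
  rw [AddChar.inv_apply, norm_addChar_apply_neg_sub_one]
  exact norm_prod_zpow_apply_sub_one_le hm Λ t

theorem norm_apply_sub_one_le_of_maximal_isDissociatedRel {V : Finset G}
    {Δ Λ : Finset (AddChar G ℂ)} (hΛ : Maximal (fun Λ => Λ ⊆ Δ ∧ IsDissociatedRel V Λ) Λ)
    {t : G} {κ : ℝ} (hκ : 0 ≤ κ)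
    (ht : ∀ χ : AddChar G ℂ, 1 / 2 ≤ ‖muHat V χ‖ → ‖χ t - 1‖ ≤ κ) {γ : AddChar G ℂ}
    (hγ : γ ∈ Δ) : ‖γ t - 1‖ ≤ κ + ∑ χ ∈ Λ, ‖χ t - 1‖ := by
  classical
  by_cases hγΛ : γ ∈ Λ
  · have hle := Finset.single_le_sum (f := fun χ : AddChar G ℂ => ‖χ t - 1‖)
      (fun _ _ => norm_nonneg _) hγΛ
    linarith
  · refine norm_apply_sub_one_le_of_not_isDissociatedRel_insert hΛ.prop.2 hγΛ (fun hins => ?_) ht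
    exact hγΛ (hΛ.le_of_ge ⟨Finset.insert_subset hγ hΛ.prop.1, hins⟩ (Finset.subset_insert γ Λ)
      (Finset.mem_insert_self γ Λ))

end Dissociated

section RegularBohrSet

variable {G : Type*} [AddCommGroup G]

theorem norm_sub_one_mul_norm_sum_le [Finite G] [DecidableEq G] (V : Finset G)
    (γ : AddChar G ℂ) (t : G) :
    ‖γ t - 1‖ * ‖∑ x ∈ V, γ x‖ ≤ 2 * (V.map (addRightEmbedding t) \ V).card := by
  set V' := V.map (addRightEmbedding t) with hV'
  have hshift : (γ t - 1) * ∑ x ∈ V, γ x = ∑ x ∈ V', γ x - ∑ x ∈ V, γ x := by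
    simp only [hV', Finset.sum_map, addRightEmbedding_apply, AddChar.map_add_eq_mul,
      ← Finset.sum_mul]
    ring
  have hnorm : ∀ Y : Finset G, ‖∑ x ∈ Y, γ x‖ ≤ Y.card := fun Y =>
    (norm_sum_le _ _).trans_eq (by simp [AddChar.norm_apply])
  have hcard : (V \ V').card = (V' \ V).card := Finset.card_sdiff_comm (Finset.card_map _).symm
  rw [← norm_mul, hshift, ← Finset.sum_sdiff_sub_sum_sdiff, two_mul]
  refine (norm_sub_le _ _).trans (add_le_add (hnorm _) ?_)
  exact (hnorm _).trans_eq (by rw [hcard])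

variable [Fintype G]

namespace BohrSet

theorem card_carrier_le_of_isRegular {B : BohrSet G} (hB : B.IsRegular) {θ : ℝ} (hθ : 0 ≤ θ)
    (hθ1 : θ ≤ 1 / (12 * B.rank)) {s : ℝ≥0} (hs : (s : ℝ) ≤ (1 + θ) * B.radius) :
    ((⟨B.freq, s⟩ : BohrSet G).carrier.card : ℝ) ≤ (1 + 12 * B.rank * θ) * B.carrier.card := by
  have hupper := (hB θ (by rwa [abs_of_nonneg hθ])).2
  rw [abs_of_nonneg hθ, div_le_iff₀ B.card_carrier_pos] at hupper
  refine le_trans ?_ hupper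
  refine Nat.cast_le.mpr (Finset.card_le_card (carrier_subset subset_rfl ?_))
  rw [← NNReal.coe_le_coe, NNReal.coe_mul, Real.coe_toNNReal _ (by linarith)]
  exact hs

theorem card_translate_sdiff_le_of_isRegular [DecidableEq G] {B : BohrSet G} (hB : B.IsRegular)
    {θ : ℝ} (hθ : 0 ≤ θ) (hθ1 : θ ≤ 1 / (12 * B.rank)) {s : ℝ≥0} (hs : (s : ℝ) ≤ θ * B.radius)
    {t : G} (ht : t ∈ (⟨B.freq, s⟩ : BohrSet G).carrier) :
    ((B.carrier.map (addRightEmbedding t) \ B.carrier).card : ℝ)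
      ≤ 12 * B.rank * θ * B.carrier.card := by
  have hupper := card_carrier_le_of_isRegular hB hθ hθ1 (s := B.radius + s) (by
    push_cast; linarith)
  have htranslate : B.carrier.map (addRightEmbedding t)
      ⊆ (⟨B.freq, B.radius + s⟩ : BohrSet G).carrier := by
    intro y hy
    obtain ⟨x, hx, rfl⟩ := Finset.mem_map.mp hy
    exact add_mem_carrier hx ht le_rfl
  have hunion := Finset.card_le_card (Finset.union_subset htranslate
    (carrier_subset (r := B.radius) subset_rfl le_self_add))
  rw [← Finset.card_sdiff_add_card] at hunion
  have : ((B.carrier.map (addRightEmbedding t) \ B.carrier).card : ℝ) + B.carrier.card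
      ≤ (⟨B.freq, B.radius + s⟩ : BohrSet G).carrier.card := mod_cast hunion
  linarith

end BohrSet

theorem BohrSet.norm_apply_sub_one_le_of_isRegular {B : BohrSet G} (hB : B.IsRegular) {θ : ℝ}
    (hθ : 0 ≤ θ) (hθ1 : θ ≤ 1 / (12 * B.rank)) {s : ℝ≥0} (hs : (s : ℝ) ≤ θ * B.radius) {t : G}
    (ht : t ∈ (⟨B.freq, s⟩ : BohrSet G).carrier) {γ : AddChar G ℂ}
    (hγ : 1 / 2 ≤ ‖muHat B.carrier γ‖) : ‖γ t - 1‖ ≤ 48 * B.rank * θ := by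
  classical
  have hpos := B.card_carrier_pos
  have hsum : ‖∑ x ∈ B.carrier, γ x‖ = B.carrier.card * ‖muHat B.carrier γ‖ := by
    rw [← Finset.card_mul_expect, norm_mul, Complex.norm_natCast, muHat]
  have hshift := norm_sub_one_mul_norm_sum_le B.carrier γ t
  rw [hsum] at hshift
  have htranslate := card_translate_sdiff_le_of_isRegular hB hθ hθ1 hs ht
  refine le_of_mul_le_mul_right ?_ hpos
  calc ‖γ t - 1‖ * B.carrier.card
      ≤ 2 * (‖γ t - 1‖ * (B.carrier.card * ‖muHat B.carrier γ‖)) := by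
        have := mul_le_mul_of_nonneg_left hγ
          (mul_nonneg (norm_nonneg (γ t - 1)) hpos.le)
        linarith
    _ ≤ 48 * B.rank * θ * B.carrier.card := by linarith

end RegularBohrSet

section LargeSpectrum

theorem exp_mul_sum_le {ι : Type*} (s : Finset ι) {y : ι → ℝ} (hy : ∀ i ∈ s, |y i| ≤ 1) (t : ℝ) :
    Real.exp (t * ∑ i ∈ s, y i)
      ≤ Real.exp (s.card * (t ^ 2 / 2)) * ∏ i ∈ s, (1 + Real.tanh t * y i) := by
  have hfactor : ∀ i ∈ s, Real.exp (t * y i) ≤ Real.cosh t * (1 + Real.tanh t * y i) := by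
    intro i hi
    have hcosh := (Real.cosh_pos t).ne'
    refine (mul_comm t (y i) ▸ Real.exp_mul_le_cosh_add_mul_sinh (hy i hi) t).trans_eq ?_
    rw [Real.tanh_eq_sinh_div_cosh]
    field_simp
  have hnonneg : ∀ i ∈ s, 0 ≤ 1 + Real.tanh t * y i := fun i hi =>
    (pos_of_mul_pos_right ((Real.exp_pos _).trans_le (hfactor i hi)) (Real.cosh_pos t).le).le
  calc Real.exp (t * ∑ i ∈ s, y i) = ∏ i ∈ s, Real.exp (t * y i) := by
        rw [Finset.mul_sum, Real.exp_sum]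
    _ ≤ ∏ i ∈ s, (Real.cosh t * (1 + Real.tanh t * y i)) :=
        Finset.prod_le_prod (fun _ _ => (Real.exp_pos _).le) hfactor
    _ = Real.cosh t ^ s.card * ∏ i ∈ s, (1 + Real.tanh t * y i) := by
        rw [Finset.prod_mul_distrib, Finset.prod_const]
    _ ≤ Real.exp (t ^ 2 / 2) ^ s.card * ∏ i ∈ s, (1 + Real.tanh t * y i) := by
        gcongr
        · exact Finset.prod_nonneg hnonneg
        · exact Real.cosh_le_exp_half_sq t
    _ = _ := by rw [← Real.exp_nat_mul]

theorem exp_expect_le {ι : Type*} {X : Finset ι} (hX : X.Nonempty) (f : ι → ℝ) :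
    Real.exp (𝔼 x ∈ X, f x) ≤ 𝔼 x ∈ X, Real.exp (f x) := by
  have hcard : (X.card : ℝ) ≠ 0 := by exact_mod_cast hX.card_pos.ne'
  have hjensen := convexOn_exp.map_sum_le (t := X) (w := fun _ => (X.card : ℝ)⁻¹) (p := f)
    (fun _ _ => by positivity) (by simp [hcard]) (fun _ _ => Set.mem_univ _)
  simpa only [smul_eq_mul, ← Finset.mul_sum, Finset.expect_eq_sum_div_card,
    div_eq_inv_mul] using hjensen

variable {G : Type*} [AddCommGroup G]

theorem expect_re_phase_mul_addChar_neg [Finite G] (X : Finset G) (γ : AddChar G ℂ) :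
    𝔼 x ∈ X, (muHat X γ / ‖muHat X γ‖ * γ (-x)).re = ‖muHat X γ‖ := by
  rw [← Complex.re_expect, ← Finset.mul_expect, expect_addChar_neg, div_mul_eq_mul_div,
    Complex.mul_conj', pow_two, mul_self_div_self, Complex.ofReal_re]

theorem exp_mul_card_le_expect_exp [Finite G] {X : Finset G} (hX : X.Nonempty)
    {Λ : Finset (AddChar G ℂ)} (hspec : ∀ γ ∈ Λ, 1 / 2 ≤ ‖muHat X γ‖) {t : ℝ} (ht : 0 ≤ t) :
    Real.exp (t * (Λ.card / 2)) ≤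
      𝔼 x ∈ X, Real.exp (t * ∑ γ ∈ Λ, (muHat X γ / ‖muHat X γ‖ * γ (-x)).re) := by
  refine (Real.exp_le_exp.mpr ?_).trans (exp_expect_le hX _)
  rw [← Finset.mul_expect, Finset.expect_sum_comm]
  simp only [expect_re_phase_mul_addChar_neg]
  gcongr
  calc (Λ.card : ℝ) / 2 = ∑ _γ ∈ Λ, (1 / 2 : ℝ) := by
        rw [Finset.sum_const, nsmul_eq_mul, mul_one_div]
    _ ≤ ∑ γ ∈ Λ, ‖muHat X γ‖ := Finset.sum_le_sum hspec

variable [Fintype G]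

theorem IsDissociatedRel.sum_mul_rieszProduct_le {V : Finset G} {Λ : Finset (AddChar G ℂ)}
    (hΛ : IsDissociatedRel V Λ) (W : Finset G) {l : ℕ} (hl : Λ.card ≤ l) {a : ℝ} (ha : 0 ≤ a)
    (ha1 : a ≤ 1) {c : AddChar G ℂ → ℂ} (hc : ∀ γ, ‖c γ‖ ≤ 1) :
    ∑ x, (conv (muFun V))^[l] (indFun W) x * rieszProduct a c Λ x ≤ 2 * W.card := by
  set β := (conv (muFun V))^[l] (indFun W)
  have hcoeff : ∀ m : AddChar G ℂ → ℤ, (∀ χ, |m χ| ≤ 1) → (∃ χ ∈ Λ, m χ ≠ 0) →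
      ‖discreteFourier β (∏ χ ∈ Λ, χ ^ m χ)‖ ≤ (1 / 2) ^ l * W.card := fun m hm hm0 =>
    (norm_discreteFourier_iterate_conv_muFun_indFun_le V W l _).trans
      (by gcongr; exact hΛ m hm hm0)
  have hriesz := norm_discreteFourier_mul_rieszProduct_one_sub_le ha hc Λ hcoeff
  rw [discreteFourier_one, discreteFourier_one, ← Complex.ofReal_sub, Complex.norm_real] at hriesz
  have hdiff := (Real.le_norm_self _).trans hriesz
  simp only [Pi.mul_apply] at hdiff
  have hpow : (1 / 2 : ℝ) ^ l * W.card * ((1 + a) ^ Λ.card - 1) ≤ W.card := by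
    calc (1 / 2 : ℝ) ^ l * W.card * ((1 + a) ^ Λ.card - 1) ≤ (1 / 2 : ℝ) ^ l * W.card * 2 ^ l := by
          gcongr
          calc (1 + a) ^ Λ.card - 1 ≤ (1 + a) ^ Λ.card := sub_le_self _ zero_le_one
            _ ≤ (1 + a) ^ l := pow_le_pow_right₀ (by linarith) hl
            _ ≤ 2 ^ l := pow_le_pow_left₀ (by linarith) (by linarith) l
      _ = W.card := by rw [mul_right_comm, ← mul_pow]; norm_num
  linarith [sum_iterate_conv_muFun_indFun_le V W l]

theorem IsDissociatedRel.card_le {X V W : Finset G} (hX : X.Nonempty) {l : ℕ}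
    (hmaj : ∀ x ∈ X, (conv (muFun V))^[l] (indFun W) x = 1) {Λ : Finset (AddChar G ℂ)}
    (hΛ : IsDissociatedRel V Λ) (hspec : ∀ γ ∈ Λ, 1 / 2 ≤ ‖muHat X γ‖) (hl : Λ.card ≤ l) :
    (Λ.card : ℝ) ≤ 8 * Real.log (2 * W.card / X.card) := by
  have : (0 : ℝ) < X.card := mod_cast hX.card_pos
  set a := Real.tanh (1 / 2) with ha
  have ha0 : 0 ≤ a := by
    rw [ha, Real.tanh_eq_sinh_div_cosh]
    exact div_nonneg (Real.sinh_nonneg_iff.mpr (by norm_num)) (Real.cosh_pos _).le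
  have ha1 : a ≤ 1 := (Real.tanh_lt_one _).le
  set c : AddChar G ℂ → ℂ := fun γ => muHat X γ / ‖muHat X γ‖ with hc
  have hc1 : ∀ γ, ‖c γ‖ ≤ 1 := fun γ => by
    rw [hc, norm_div, Complex.norm_real, norm_norm]
    exact div_self_le_one _
  have hcos : ∀ γ x, |(c γ * γ (-x)).re| ≤ 1 := fun γ x =>
    (Complex.abs_re_le_norm _).trans (by rw [norm_mul, AddChar.norm_apply, mul_one]; exact hc1 γ)
  have hriesz0 : ∀ x, 0 ≤ rieszProduct a c Λ x := fun x =>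
    Finset.prod_nonneg fun γ _ => by nlinarith [abs_le.mp (hcos γ x)]
  have hmass : (∑ x ∈ X, rieszProduct a c Λ x) ≤ 2 * W.card := by
    refine le_trans ?_ (hΛ.sum_mul_rieszProduct_le W hl ha0 ha1 hc1)
    refine (Finset.sum_le_sum fun x hx => ?_).trans
      (Finset.sum_le_univ_sum_of_nonneg fun x => mul_nonneg
        (iterate_conv_muFun_nonneg V (indFun_nonneg W) l x) (hriesz0 x))
    rw [hmaj x hx, one_mul]
  have hexp : Real.exp (Λ.card / 8) * Real.exp (Λ.card / 8)
      ≤ Real.exp (Λ.card / 8) * (2 * W.card / X.card) := by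
    calc Real.exp (Λ.card / 8) * Real.exp (Λ.card / 8) = Real.exp (1 / 2 * (Λ.card / 2)) := by
          rw [← Real.exp_add]; ring_nf
      _ ≤ 𝔼 x ∈ X, Real.exp (1 / 2 * ∑ γ ∈ Λ, (c γ * γ (-x)).re) :=
          exp_mul_card_le_expect_exp hX hspec (by norm_num)
      _ ≤ 𝔼 x ∈ X, Real.exp (Λ.card * ((1 / 2) ^ 2 / 2)) * rieszProduct a c Λ x :=
          Finset.expect_le_expect fun x _ => exp_mul_sum_le Λ (fun γ _ => hcos γ x) _
      _ = Real.exp (Λ.card / 8) * ((∑ x ∈ X, rieszProduct a c Λ x) / X.card) := by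
          rw [← Finset.mul_expect, Finset.expect_eq_sum_div_card]; ring_nf
      _ ≤ Real.exp (Λ.card / 8) * (2 * W.card / X.card) := by gcongr
  have hle := le_of_mul_le_mul_left hexp (Real.exp_pos _)
  linarith [(Real.le_log_iff_exp_le ((Real.exp_pos _).trans_le hle)).mpr hle]

namespace BohrSet

theorem card_le_of_isDissociatedRel {B : BohrSet G} (hB : B.IsRegular) {X : Finset G}
    (hX : X.Nonempty) (hXB : X ⊆ B.carrier) {l : ℕ}
    (hl : 8 * Real.log (4 * B.carrier.card / X.card) < l) {r : ℝ≥0}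
    (hr : l * (r : ℝ) ≤ 1 / (12 * B.rank) * B.radius) {Λ : Finset (AddChar G ℂ)}
    (hΛ : IsDissociatedRel (⟨B.freq, r⟩ : BohrSet G).carrier Λ)
    (hspec : ∀ γ ∈ Λ, 1 / 2 ≤ ‖muHat X γ‖) : Λ.card ≤ l := by
  have : (0 : ℝ) < X.card := mod_cast hX.card_pos
  set W := (⟨B.freq, B.radius + l * r⟩ : BohrSet G).carrier with hW
  have hWpos : (0 : ℝ) < W.card := card_carrier_pos _
  have hWcard : (W.card : ℝ) ≤ 2 * B.carrier.card := by
    refine (card_carrier_le_of_isRegular hB (by positivity) le_rfl ?_).trans ?_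
    · push_cast; linarith
    · rw [mul_one_div]
      gcongr
      linarith [div_self_le_one (12 * (B.rank : ℝ))]
  have hmaj : ∀ x ∈ X, (conv (muFun (⟨B.freq, r⟩ : BohrSet G).carrier))^[l] (indFun W) x = 1 :=
    fun x hx => iterate_conv_muFun_indFun_eq_one l le_rfl (hXB hx)
  have hlog : 8 * Real.log (2 * W.card / X.card) < l := by
    refine lt_of_le_of_lt ?_ hl
    gcongr 8 * Real.log (?_ / _)
    linarith
  by_contra! hlt
  obtain ⟨Λ', hsub, hcard⟩ := Finset.exists_subset_card_eq hlt.le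
  have hle := (hΛ.subset hsub).card_le hX hmaj (fun γ hγ => hspec γ (hsub hγ)) hcard.le
  rw [hcard] at hle
  linarith

theorem norm_apply_sub_one_le_of_mem_union [DecidableEq (AddChar G ℂ)] {B : BohrSet G}
    (hB : B.IsRegular) (hd : 0 < B.rank) {Δ Λ : Finset (AddChar G ℂ)}
    (hΛ : Maximal (fun Λ => Λ ⊆ Δ ∧ IsDissociatedRel B.carrier Λ) Λ) {κ : ℝ} (hκ : 0 ≤ κ)
    (hκ8 : κ ≤ 8) {R : ℝ≥0} (hRB : 96 * B.rank * (R : ℝ) ≤ κ * B.radius)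
    (hRΛ : 2 * Λ.card * (R : ℝ) ≤ κ) {t : G}
    (ht : t ∈ (⟨B.freq ∪ Λ, R⟩ : BohrSet G).carrier) {γ : AddChar G ℂ} (hγ : γ ∈ Δ) :
    ‖γ t - 1‖ ≤ κ := by
  have : (0 : ℝ) < B.rank := mod_cast hd
  have htB : t ∈ (⟨B.freq, R⟩ : BohrSet G).carrier :=
    carrier_subset Finset.subset_union_left le_rfl ht
  have hlarge : ∀ χ : AddChar G ℂ, 1 / 2 ≤ ‖muHat B.carrier χ‖ → ‖χ t - 1‖ ≤ κ / 2 := by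
    intro χ hχ
    refine (norm_apply_sub_one_le_of_isRegular hB (θ := κ / (96 * B.rank)) (by positivity) ?_ ?_
      htB hχ).trans_eq (by field_simp; ring)
    · rw [div_le_div_iff₀ (by positivity) (by positivity)]
      nlinarith
    · rw [div_mul_eq_mul_div, le_div_iff₀ (by positivity)]
      linarith
  have hsum : ∑ χ ∈ Λ, ‖χ t - 1‖ ≤ κ / 2 := by
    have hle : ∑ χ ∈ Λ, ‖χ t - 1‖ ≤ ∑ _χ ∈ Λ, (R : ℝ) := Finset.sum_le_sum fun χ hχ =>
      mem_carrier.mp ht χ (Finset.mem_union_right _ hχ)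
    rw [Finset.sum_const, nsmul_eq_mul] at hle
    linarith
  linarith [norm_apply_sub_one_le_of_maximal_isDissociatedRel hΛ (by positivity) hlarge hγ]

theorem exists_isRegular_mul_le {B : BohrSet G} (hd : 0 < B.rank) (hρ : (B.radius : ℝ) ≤ 1 / 4)
    {q : ℝ} (hq : 1 ≤ q) :
    ∃ r : ℝ≥0, (B.radius : ℝ) ≤ 81 * q * r ∧ q * r ≤ B.radius ∧
      (⟨B.freq, r⟩ : BohrSet G).IsRegular := by
  have hq0 : 0 < q := by linarith
  have hval : ((B.radius / q.toNNReal : ℝ≥0) : ℝ) = B.radius / q := by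
    rw [NNReal.coe_div, Real.coe_toNNReal _ hq0.le]
  obtain ⟨r, hlower, hupper, hreg⟩ := exists_isRegular (G := G) (Finset.card_pos.mp hd)
    (R := B.radius / q.toNNReal)
    (by rw [hval]; exact (div_le_self B.radius.coe_nonneg hq).trans hρ)
  refine ⟨r, ?_, ?_, hreg⟩
  · rw [hval, div_div, div_le_iff₀ (by positivity)] at hlower
    linarith
  · rw [← NNReal.coe_le_coe, hval, le_div_iff₀ hq0] at hupper
    linarith

/-- A local form of Chang's theorem. -/
theorem exists_card_le_forall_norm_apply_sub_one_le [DecidableEq (AddChar G ℂ)] {B : BohrSet G}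
    (hB : B.IsRegular) (hd : 0 < B.rank) (hρ : (B.radius : ℝ) ≤ 1 / 4) {X : Finset G}
    (hX : X.Nonempty) (hXB : X ⊆ B.carrier) {l : ℕ} (hl0 : 0 < l)
    (hl : 8 * Real.log (4 * B.carrier.card / X.card) < l) {κ : ℝ} (hκ : 0 ≤ κ) (hκ1 : κ ≤ 1) :
    ∃ Λ : Finset (AddChar G ℂ), Λ.card ≤ l ∧ ∀ R : ℝ≥0,
      (R : ℝ) * (93312 * (B.rank : ℝ) ^ 2 * l) ≤ B.radius * κ →
      ∀ γ : AddChar G ℂ, 1 / 2 ≤ ‖muHat X γ‖ → ∀ t ∈ (⟨B.freq ∪ Λ, R⟩ : BohrSet G).carrier,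
        ‖γ t - 1‖ ≤ κ := by
  have hd1 : (1 : ℝ) ≤ B.rank := mod_cast hd
  have hl1 : (1 : ℝ) ≤ l := mod_cast hl0
  have hdl : 1 ≤ (B.rank : ℝ) * l := one_le_mul_of_one_le_of_one_le hd1 hl1
  obtain ⟨r, hρr, hrρ, hreg⟩ := exists_isRegular_mul_le hd hρ (q := 12 * (B.rank * l))
    (by linarith)
  obtain ⟨Λ, hΛ⟩ := exists_maximal_isDissociatedRel (⟨B.freq, r⟩ : BohrSet G).carrier
    (Finset.univ.filter fun γ : AddChar G ℂ => 1 / 2 ≤ ‖muHat X γ‖)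
  have hcard : Λ.card ≤ l := by
    refine card_le_of_isDissociatedRel hB hX hXB hl ?_ hΛ.prop.2
      fun γ hγ => (Finset.mem_filter.mp (hΛ.prop.1 hγ)).2
    rw [one_div_mul_eq_div, le_div_iff₀ (by positivity)]
    linarith
  refine ⟨Λ, hcard, fun R hR γ hγ t ht => ?_⟩
  refine norm_apply_sub_one_le_of_mem_union hreg hd hΛ hκ (by linarith) ?_ ?_ ht
    (by simpa using hγ)
  · change 96 * (B.rank : ℝ) * R ≤ κ * r
    refine le_of_mul_le_mul_left ?_ (by positivity : (0 : ℝ) < 972 * (B.rank * l))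
    calc 972 * (B.rank * l) * (96 * (B.rank : ℝ) * R) = R * (93312 * (B.rank : ℝ) ^ 2 * l) := by
          ring
      _ ≤ B.radius * κ := hR
      _ ≤ 972 * (B.rank * l) * r * κ := by gcongr; linarith
      _ = 972 * (B.rank * l) * (κ * r) := by ring
  · calc 2 * Λ.card * (R : ℝ) ≤ 2 * l * R := by gcongr
      _ ≤ 93312 * (B.rank : ℝ) ^ 2 * l * R := by
          gcongr
          nlinarith
      _ ≤ 1 * κ := by
          rw [mul_comm]
          refine hR.trans ?_
          gcongr
          linarith
      _ = κ := one_mul κ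

end BohrSet

end LargeSpectrum

namespace BohrSet

variable {G : Type*} [AddCommGroup G] [Fintype G] {B : BohrSet G}

/-- The part of a Bohr set at relative depth at least `u`: its points survive translations by
`B_u`. -/
noncomputable def core (B : BohrSet G) (u : ℝ) : Finset G := (B.dilate (1 - u).toNNReal).carrier

theorem core_zero (B : BohrSet G) : B.core 0 = B.carrier := by
  simp [core, dilate]

theorem core_antitone (B : BohrSet G) : Antitone B.core := fun _ _ h =>
  carrier_subset subset_rfl (mul_le_mul_left (Real.toNNReal_le_toNNReal (by linarith)) _)

theorem core_subset_carrier (B : BohrSet G) {u : ℝ} (hu : 0 ≤ u) : B.core u ⊆ B.carrier :=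
  B.core_zero ▸ B.core_antitone hu

theorem add_mem_core {u v : ℝ} {τ : ℝ≥0} (hv : v ≤ 1) (huv : u + τ ≤ v) {x y : G}
    (hx : x ∈ B.core v) (hy : y ∈ (B.dilate τ).carrier) : x + y ∈ B.core u := by
  refine add_mem_carrier hx hy ?_
  rw [← add_mul]
  refine mul_le_mul_left ?_ _
  rw [← NNReal.coe_le_coe, NNReal.coe_add, Real.coe_toNNReal _ (by linarith),
    Real.coe_toNNReal _ (by linarith [τ.coe_nonneg])]
  linarith

theorem add_sub_mem_core {u v : ℝ} {τ : ℝ≥0} (hv : v ≤ 1) (huv : u + 2 * τ ≤ v) {x y z : G}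
    (hx : x ∈ B.core v) (hy : y ∈ (B.dilate τ).carrier) (hz : z ∈ (B.dilate τ).carrier) :
    x + (y - z) ∈ B.core u := by
  rw [← add_sub_assoc, sub_eq_add_neg]
  exact add_mem_core (by linarith [τ.coe_nonneg]) le_rfl
    (add_mem_core hv (by linarith) hx hy) (neg_mem_carrier hz)

theorem card_sdiff_core_le_of_isRegular [DecidableEq G] (hB : B.IsRegular) {u : ℝ} (hu : 0 ≤ u)
    (hu1 : u ≤ 1 / (12 * B.rank)) :
    ((B.carrier \ B.core u).card : ℝ) ≤ 12 * B.rank * u * B.carrier.card := by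
  have hlower := (hB (-u) (by rwa [abs_neg, abs_of_nonneg hu])).1
  rw [abs_neg, abs_of_nonneg hu, le_div_iff₀ B.card_carrier_pos, ← sub_eq_add_neg] at hlower
  rw [Finset.cast_card_sdiff (B.core_subset_carrier hu)]
  unfold core
  linarith

end BohrSet

section Translates

variable {G : Type*} {p : ℝ}

theorem lpNormOn_le_of_card_le (hp : 0 < p) {E : Finset G} {f : G → ℝ} (hf : ∀ x ∈ E, |f x| ≤ 1)
    {υ N : ℝ} (hυ : 0 ≤ υ) (hN : 0 ≤ N) (hE : (E.card : ℝ) ≤ υ ^ p * N) :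
    lpNormOn p E f ≤ υ * N ^ (1 / p) := by
  calc lpNormOn p E f ≤ 1 * (E.card : ℝ) ^ (1 / p) := lpNormOn_le_of_abs_le hp zero_le_one hf
    _ ≤ (υ ^ p * N) ^ (1 / p) := by rw [one_mul]; gcongr
    _ = υ * N ^ (1 / p) := by
        rw [Real.mul_rpow (by positivity) hN, one_div, Real.rpow_rpow_inv hυ hp.ne']

variable [AddCommGroup G]

theorem lpNormOn_translate_sub_le_of_approx (hp : 1 ≤ p) {E E' : Finset G} (hE : E' ⊆ E) {t : G}
    (ht : ∀ x ∈ E', x + t ∈ E) {P g : G → ℝ} {D ω : ℝ} (hP : lpNormOn p E (P - g) ≤ D)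
    (hω0 : 0 ≤ ω) (hω : ∀ x, |P (x + t) - P x| ≤ ω) :
    lpNormOn p E' (fun x => g (x + t) - g x) ≤ 2 * D + ω * (E'.card : ℝ) ^ (1 / p) := by
  have hp0 : 0 ≤ p := by linarith
  have hsplit : (fun x => g (x + t) - g x)
      = (g - P) ∘ (· + t) + ((fun x => P (x + t) - P x) + (P - g)) := by
    funext x
    simp only [Pi.add_apply, Pi.sub_apply, Function.comp_apply]
    ring
  have hshift : lpNormOn p E' ((g - P) ∘ (· + t)) ≤ D :=
    (lpNormOn_comp_le hp0 (add_left_injective t) ht _).trans (lpNormOn_sub_comm p E g P ▸ hP)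
  have hmiddle : lpNormOn p E' (fun x => P (x + t) - P x) ≤ ω * (E'.card : ℝ) ^ (1 / p) :=
    lpNormOn_le_of_abs_le (by linarith) hω0 fun x _ => hω x
  rw [hsplit]
  refine (lpNormOn_add_le hp E' _ _).trans ?_
  linarith [lpNormOn_add_le hp E' (fun x => P (x + t) - P x) (P - g),
    (lpNormOn_mono hp0 hE (P - g)).trans hP]

variable [Fintype G] {B : BohrSet G} {τ : ℝ≥0} {k : ℕ} {X : Finset G} {g F : G → ℝ} {D : ℝ}

theorem BohrSet.lpNormOn_core_iterate_diffAverage_sub_le (hp : 1 ≤ p)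
    (hτ : 2 * (k + 1) * (τ : ℝ) ≤ 1) (hX : X.Nonempty) (hXB : X ⊆ (B.dilate τ).carrier)
    (hF : ∀ s ∈ X, lpNormOn p B.carrier (fun x => F (x + s) - g x) ≤ D) :
    lpNormOn p (B.core (2 * (k + 1) * τ)) ((diffAverage X)^[k] g - g) ≤ k * (2 * D) := by
  have : 0 ≤ (τ : ℝ) := τ.coe_nonneg
  have hdepth : ∀ j ≤ k, 2 * (j + 1) * (τ : ℝ) ≤ 1 := fun j hj => by
    refine le_trans ?_ hτ
    gcongr
  refine lpNormOn_iterate_diffAverage_sub_le (E := fun j : ℕ => B.core (2 * (j + 1) * τ)) hp hX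
    (fun j => B.core_antitone ?_) (fun j hj x hx s hs t ht => ?_) fun s hs t ht => ?_
  · gcongr
    simp
  · refine BohrSet.add_sub_mem_core (by exact_mod_cast hdepth (j + 1) hj) ?_ hx (hXB hs) (hXB ht)
    push_cast
    linarith
  · refine lpNormOn_translate_diff_sub_le hp hF (B.core_subset_carrier (by positivity))
      (fun x hx y hy z hz => ?_) hs ht
    rw [← B.core_zero]
    exact BohrSet.add_sub_mem_core (hdepth 0 k.zero_le) (by push_cast; linarith) hx (hXB hy)
      (hXB hz)

theorem BohrSet.lpNormOn_translate_sub_le [DecidableEq G] (hp : 1 ≤ p)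
    (hτ : (2 * k + 3) * (τ : ℝ) ≤ 1) (hX : X.Nonempty) (hXB : X ⊆ (B.dilate τ).carrier)
    (hF : ∀ s ∈ X, lpNormOn p B.carrier (fun x => F (x + s) - g x) ≤ D)
    {t : G} (ht : t ∈ (B.dilate τ).carrier) (hg : ∀ x, |g (x + t) - g x| ≤ 1) {ω υ : ℝ}
    (hω0 : 0 ≤ ω)
    (hω : ∀ x, |(diffAverage X)^[k] g (x + t) - (diffAverage X)^[k] g x| ≤ ω) (hυ0 : 0 ≤ υ)
    (hυ : ((B.carrier \ B.core ((2 * k + 3) * τ)).card : ℝ) ≤ υ ^ p * B.carrier.card) :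
    lpNormOn p B.carrier (fun x => g (x + t) - g x)
      ≤ 4 * k * D + (ω + υ) * (B.carrier.card : ℝ) ^ (1 / p) := by
  have : 0 ≤ (τ : ℝ) := τ.coe_nonneg
  have hiter := lpNormOn_core_iterate_diffAverage_sub_le (k := k) hp (by linarith) hX hXB hF
  have hinner := lpNormOn_translate_sub_le_of_approx hp
    (B.core_antitone (by linarith : 2 * (k + 1) * (τ : ℝ) ≤ (2 * k + 3) * τ))
    (fun x hx => add_mem_core hτ (by linarith) hx ht) hiter hω0 hω
  have hboundary := lpNormOn_le_of_card_le (by linarith : 0 < p) (fun x _ => hg x) hυ0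
    (Nat.cast_nonneg _) hυ
  have hcard : ω * ((B.core ((2 * k + 3) * τ)).card : ℝ) ^ (1 / p)
      ≤ ω * (B.carrier.card : ℝ) ^ (1 / p) := by
    gcongr
    exact B.core_subset_carrier (by positivity)
  linarith [lpNormOn_le_add_sdiff hp B.carrier (B.core ((2 * k + 3) * τ))
    (fun x => g (x + t) - g x)]

theorem avgLpNorm_conv_muFun_sub_le (hp : 1 ≤ p) (E : Finset G) {T : Finset G} (hT : T.Nonempty)
    (hneg : ∀ t ∈ T, -t ∈ T)
    (h : ∀ t ∈ T, avgLpNorm p E (fun x => g (x + t) - g x) ≤ D) :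
    avgLpNorm p E (fun x => conv g (muFun T) x - g x) ≤ D := by
  rcases E.eq_empty_or_nonempty with rfl | hE
  · obtain ⟨t, ht⟩ := hT
    simpa [avgLpNorm] using h t ht
  have hE0 : 0 < (E.card : ℝ) ^ (1 / p) :=
    Real.rpow_pos_of_pos (Nat.cast_pos.mpr hE.card_pos) _
  simp only [avgLpNorm_eq_lpNormOn_div, div_le_iff₀ hE0] at h ⊢
  have haverage : (fun x => conv g (muFun T) x - g x)
      = 𝔼 t ∈ T, fun x => g (x + -t) - g x := by
    funext x
    rw [conv_muFun_right, Finset.expect_apply, Finset.expect_sub_distrib,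
      Finset.expect_const hT]
    simp only [sub_eq_add_neg]
  rw [haverage]
  exact lpNormOn_expect_le hp E hT _ fun t ht => h (-t) (hneg t ht)

end Translates

theorem avgLpNorm_le_of_lpNormOn_le {G : Type*} {m : ℝ} (hm : 0 < m) {E : Finset G}
    (hE : E.Nonempty) {h f : G → ℝ} {a b c : ℝ}
    (hle : lpNormOn (2 * m) E h ≤ a * lpNormOn m E f ^ (1 / 2 : ℝ)
      + b * lpNormOn 1 E f ^ (1 / (2 * m)) + c * (E.card : ℝ) ^ (1 / (2 * m))) :
    avgLpNorm (2 * m) E h ≤ a * avgLpNorm m E f ^ (1 / 2 : ℝ)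
      + b * avgLpNorm 1 E f ^ (1 / (2 * m)) + c := by
  have hE0 : 0 < (E.card : ℝ) := Nat.cast_pos.mpr hE.card_pos
  have hm_exponent : 1 / m * (1 / 2) = 1 / (2 * m) := by field_simp
  have hone_exponent : 1 / 1 * (1 / (2 * m)) = 1 / (2 * m) := by ring
  simp only [avgLpNorm_eq_lpNormOn_div]
  rw [div_le_iff₀ (by positivity), Real.div_rpow (lpNormOn_nonneg _ _ _) (by positivity),
    Real.div_rpow (lpNormOn_nonneg _ _ _) (by positivity), ← Real.rpow_mul hE0.le,
    ← Real.rpow_mul hE0.le, hm_exponent, hone_exponent]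
  refine hle.trans (le_of_eq ?_)
  field_simp

section AlmostPeriods

theorem log_density_le {b x s K : ℝ} {n : ℕ} (hb : 0 < b) (hx : 0 < x) (hs : 0 < s) (hK : 1 ≤ K)
    (h : s ≤ 2 * K ^ n * x) :
    Real.log (4 * b / x) ≤ (n + 3) * Real.log (2 * K) + Real.log (1 / (s / b)) := by
  have hpow : 8 * K ^ n ≤ (2 * K) ^ (n + 3) := by
    calc 8 * K ^ n = 2 ^ 3 * K ^ n := by norm_num
      _ ≤ (2 * K) ^ 3 * (2 * K) ^ n := by gcongr <;> linarith
      _ = (2 * K) ^ (n + 3) := by ring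
  have hratio : 4 * b / x ≤ (2 * K) ^ (n + 3) * (1 / (s / b)) := by
    rw [one_div_div, ← mul_div_assoc, div_le_div_iff₀ hx hs]
    calc 4 * b * s ≤ 4 * b * (2 * K ^ n * x) := by gcongr
      _ = 8 * K ^ n * (b * x) := by ring
      _ ≤ (2 * K) ^ (n + 3) * (b * x) := by gcongr
      _ = (2 * K) ^ (n + 3) * b * x := by ring
  calc Real.log (4 * b / x) ≤ Real.log ((2 * K) ^ (n + 3) * (1 / (s / b))) :=
        Real.log_le_log (by positivity) hratio
    _ = (n + 3) * Real.log (2 * K) + Real.log (1 / (s / b)) := by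
        rw [Real.log_mul (by positivity) (by positivity), Real.log_pow]
        push_cast
        ring

theorem mul_rpow_div_le {N ε e : ℝ} (hN : 1 ≤ N) (hε : 0 ≤ ε) (he : 1 ≤ e) :
    N * (ε / N) ^ e ≤ ε ^ e := by
  have hN0 : 0 < N := by linarith
  rw [Real.div_rpow hε hN0.le, ← mul_div_assoc, div_le_iff₀ (by positivity), mul_comm]
  gcongr
  exact Real.self_le_rpow_of_one_le hN he

variable {G : Type*}

theorem nonempty_of_card_le_mul {S X : Finset G} (hS : S.Nonempty) {c : ℝ}
    (h : (S.card : ℝ) ≤ c * X.card) : X.Nonempty := by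
  rw [Finset.nonempty_iff_ne_empty]
  rintro rfl
  rw [Finset.card_empty, Nat.cast_zero, mul_zero, Nat.cast_nonpos] at h
  exact hS.card_pos.ne' h

variable [AddCommGroup G]

theorem one_le_of_card_add_le [DecidableEq G] {A S : Finset G} {K : ℝ} (hA : A.Nonempty)
    (hS : S.Nonempty) (hK : ((A + S).card : ℝ) ≤ K * A.card) : 1 ≤ K := by
  have hcard : (A.card : ℝ) ≤ (A + S).card := by
    exact_mod_cast Finset.card_le_card_add_right hS
  refine le_of_mul_le_mul_right ?_ (Nat.cast_pos.mpr hA.card_pos : (0 : ℝ) < A.card)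
  linarith

theorem BohrSet.radius_dilate_le {B : BohrSet G} {τ : ℝ≥0} (hρ : B.radius ≤ 2)
    (hτ : (τ : ℝ) ≤ 1 / 8) : ((B.dilate τ).radius : ℝ) ≤ 1 / 4 := by
  have hρ' : (B.radius : ℝ) ≤ 2 := by exact_mod_cast hρ
  calc ((B.dilate τ).radius : ℝ) = τ * B.radius := NNReal.coe_mul _ _
    _ ≤ 1 / 8 * 2 := by gcongr
    _ = 1 / 4 := by norm_num

variable [Fintype G]

theorem abs_conv_muFun_indFun_sub_le_one {A : Finset G} (hA : A.Nonempty) (L : Finset G)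
    (x y : G) : |conv (muFun A) (indFun L) x - conv (muFun A) (indFun L) y| ≤ 1 :=
  have hnonneg := conv_muFun_nonneg A (indFun_nonneg L)
  have hle := conv_muFun_le_one hA (indFun_le_one L)
  abs_sub_le_of_nonneg_of_le (hnonneg x) (hle x) (hnonneg y) (hle y)

variable {B : BohrSet G}

theorem BohrSet.exists_isSub_forall_norm_apply_sub_one_le (hB : B.IsRegular) (hd : 0 < B.rank)
    (hρ : (B.radius : ℝ) ≤ 1 / 4) {X : Finset G} (hX : X.Nonempty) (hXB : X ⊆ B.carrier)
    {l : ℕ} (hl0 : 0 < l) (hl : 8 * Real.log (4 * B.carrier.card / X.card) < l) {κ : ℝ}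
    (hκ : 0 < κ) (hκ1 : κ ≤ 1) :
    ∃ T : BohrSet G, T.IsRegular ∧ T.IsSub B ∧ T.rank ≤ B.rank + l ∧
      B.radius * κ ≤ 81 * (93312 * B.rank ^ 2 * l) * T.radius ∧
      ∀ γ, 1 / 2 ≤ ‖muHat X γ‖ → ∀ t ∈ T.carrier, ‖γ t - 1‖ ≤ κ := by
  classical
  obtain ⟨Λ, hΛ, hspectrum⟩ :=
    exists_card_le_forall_norm_apply_sub_one_le hB hd hρ hX hXB hl0 hl hκ.le hκ1
  have hd1 : (1 : ℝ) ≤ B.rank := by exact_mod_cast hd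
  have hl1 : (1 : ℝ) ≤ l := by exact_mod_cast hl0
  have hq : 1 ≤ 93312 * (B.rank : ℝ) ^ 2 * l / κ := by
    rw [one_le_div hκ]
    nlinarith [one_le_mul_of_one_le_of_one_le (one_le_pow₀ hd1 (n := 2)) hl1]
  obtain ⟨r, hr_lower, hr_upper, hr⟩ := exists_isRegular_mul_le (B := ⟨B.freq ∪ Λ, B.radius⟩)
    (hd.trans_le (Finset.card_le_card Finset.subset_union_left)) hρ hq
  refine ⟨⟨B.freq ∪ Λ, r⟩, hr, ⟨Finset.subset_union_left, ?_⟩, ?_, ?_, hspectrum r ?_⟩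
  · exact NNReal.coe_le_coe.mp ((le_mul_of_one_le_left r.coe_nonneg hq).trans hr_upper)
  · exact (Finset.card_union_le _ _).trans (Nat.add_le_add_left hΛ _)
  · rw [← le_div_iff₀ hκ]
    exact hr_lower.trans_eq (by ring)
  · rw [← div_le_iff₀ hκ]
    exact le_of_eq_of_le (by ring) hr_upper

variable {τ : ℝ≥0} {m ε δ : ℝ} {k : ℕ} {X : Finset G} {g F f : G → ℝ}

theorem BohrSet.avgLpNorm_translate_sub_le [DecidableEq G] (hm : 1 ≤ m) (hε : 0 ≤ ε)
    (hδ : 0 ≤ δ) (hk : 1 ≤ k) (hτ : (2 * k + 3) * (τ : ℝ) ≤ 1) (hX : X.Nonempty)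
    (hXB : X ⊆ (B.dilate τ).carrier)
    (hF : ∀ s ∈ X, lpNormOn (2 * m) B.carrier (fun x => F (x + s) - g x)
      ≤ 2 * (ε / (8 * k) * lpNormOn m B.carrier f ^ (1 / 2 : ℝ)
        + (ε / (8 * k)) ^ (2 - 1 / m) * lpNormOn 1 B.carrier f ^ (1 / (2 * m))))
    {t : G} (ht : t ∈ (B.dilate τ).carrier) (hg : ∀ x, |g (x + t) - g x| ≤ 1)
    (hsmooth : ∀ x, |(diffAverage X)^[k] g (x + t) - (diffAverage X)^[k] g x| ≤ δ / 4)
    (hboundary : ((B.carrier \ B.core ((2 * k + 3) * τ)).card : ℝ)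
      ≤ (δ / 4) ^ (2 * m) * B.carrier.card) :
    avgLpNorm (2 * m) B.carrier (fun x => g (x + t) - g x)
      ≤ ε * avgLpNorm m B.carrier f ^ (1 / 2 : ℝ)
        + ε ^ (2 - 1 / m) * avgLpNorm 1 B.carrier f ^ (1 / (2 * m)) + δ := by
  have hk1 : (1 : ℝ) ≤ k := by exact_mod_cast hk
  have hexponent : 1 ≤ 2 - 1 / m := by linarith [(div_le_one (by linarith)).mpr hm]
  have htail := mul_rpow_div_le (by linarith : (1 : ℝ) ≤ 8 * k) hε hexponent
  refine avgLpNorm_le_of_lpNormOn_le (by linarith) B.carrier_nonempty ?_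
  set a := lpNormOn m B.carrier f ^ (1 / 2 : ℝ)
  set b := lpNormOn 1 B.carrier f ^ (1 / (2 * m))
  have hb : 0 ≤ b := Real.rpow_nonneg (lpNormOn_nonneg _ _ _) _
  calc lpNormOn (2 * m) B.carrier (fun x => g (x + t) - g x)
      ≤ 4 * k * (2 * (ε / (8 * k) * a + (ε / (8 * k)) ^ (2 - 1 / m) * b))
        + (δ / 4 + δ / 4) * (B.carrier.card : ℝ) ^ (1 / (2 * m)) :=
        lpNormOn_translate_sub_le (by linarith) hτ hX hXB hF ht hg (by positivity) hsmooth
          (by positivity) hboundary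
    _ = 8 * k * (ε / (8 * k)) * a + 8 * k * (ε / (8 * k)) ^ (2 - 1 / m) * b
        + δ / 2 * (B.carrier.card : ℝ) ^ (1 / (2 * m)) := by ring
    _ ≤ ε * a + ε ^ (2 - 1 / m) * b + δ * (B.carrier.card : ℝ) ^ (1 / (2 * m)) := by
        rw [mul_div_cancel₀ ε (by positivity : (8 * k : ℝ) ≠ 0)]
        gcongr
        linarith

theorem BohrSet.exists_isSub_forall_avgLpNorm_translate_sub_le [DecidableEq G] {K κ : ℝ}
    {A L S : Finset G} {n l : ℕ} (hm : 1 ≤ m) (hε : 0 < ε) (hδ : 0 ≤ δ) (hδ1 : δ ≤ 1)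
    (hA : A.Nonempty) (hS : S.Nonempty) (hK : ((A + S).card : ℝ) ≤ K * A.card)
    (hd : 1 ≤ B.rank) (hρ : B.radius ≤ 2) (hB : B.IsRegular) (hBτ : (B.dilate τ).IsRegular)
    (hSB : S ⊆ (B.dilate τ).carrier) (hk : 1 ≤ k) (hn : 192 * m ≤ n * (ε / (8 * k)) ^ 2)
    (hboundary : 12 * B.rank * ((2 * k + 3) * τ) ≤ (δ / 4) ^ (2 * m)) (hκ : 0 < κ) (hκ1 : κ ≤ 1)
    (hsmooth : 1 / √((A.card : ℝ) / L.card) * (κ + 2 * (1 / 4) ^ k) ≤ δ / 4)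
    (hl0 : 0 < l)
    (hl : 8 * ((n + 3) * Real.log (2 * K)
      + Real.log (1 / ((S.card : ℝ) / (B.dilate τ).carrier.card))) < l)
    (hg : g = conv (muFun A) (indFun L)) (hf : f = fun x => g x * (1 - g x)) :
    ∃ T : BohrSet G, T.IsRegular ∧ T.IsSub (B.dilate τ) ∧ T.rank ≤ B.rank + l ∧
      τ * B.radius * κ ≤ 81 * (93312 * B.rank ^ 2 * l) * T.radius ∧
      ∀ t ∈ T.carrier, avgLpNorm (2 * m) B.carrier (fun x => g (x + t) - g x)
        ≤ ε * avgLpNorm m B.carrier f ^ (1 / 2 : ℝ)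
          + ε ^ (2 - 1 / m) * avgLpNorm 1 B.carrier f ^ (1 / (2 * m)) + δ := by
  have hd1 : (1 : ℝ) ≤ B.rank := by exact_mod_cast hd
  have : (1 : ℝ) ≤ k := by exact_mod_cast hk
  have hυ : (δ / 4) ^ (2 * m) ≤ 1 :=
    Real.rpow_le_one (by positivity) (by linarith) (by linarith)
  have hdepth : (2 * k + 3) * (τ : ℝ) ≤ 1 / (12 * B.rank) := by
    rw [le_div_iff₀ (by positivity)]
    linarith
  have hdepth1 : (2 * k + 3) * (τ : ℝ) ≤ 1 / 12 :=
    hdepth.trans (one_div_le_one_div_of_le (by norm_num) (by linarith))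
  have hradius : ((B.dilate τ).radius : ℝ) ≤ 1 / 4 :=
    radius_dilate_le hρ (by nlinarith [τ.coe_nonneg])
  obtain ⟨X, hXS, hXcard, F, hF⟩ := exists_translates_lpNormOn_le hA hS hK (indFun_nonneg L)
    (indFun_le_one L) B.carrier hm (by positivity) hn hg hf
  have hX : X.Nonempty := nonempty_of_card_le_mul hS hXcard
  have hlog := log_density_le (B.dilate τ).card_carrier_pos (Nat.cast_pos.mpr hX.card_pos)
    (Nat.cast_pos.mpr hS.card_pos) (one_le_of_card_add_le hA hS hK) hXcard
  obtain ⟨T, hT, hTB, hrank, hTradius, hspectrum⟩ :=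
    exists_isSub_forall_norm_apply_sub_one_le hBτ hd hradius hX (hXS.trans hSB) hl0
      (by linarith) hκ hκ1
  refine ⟨T, hT, hTB, hrank, hTradius, fun t ht => ?_⟩
  refine avgLpNorm_translate_sub_le hm hε.le hδ hk (by linarith) hX (hXS.trans hSB) hF
    (carrier_subset hTB.1 hTB.2 ht)
    (fun x => hg ▸ abs_conv_muFun_indFun_sub_le_one hA L _ _) (fun x => ?_)
    ((B.card_sdiff_core_le_of_isRegular hB (by positivity) hdepth).trans (by gcongr))
  refine (abs_iterate_diffAverage_translate_sub_le X g hκ.le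
    (fun γ hγ => hspectrum γ hγ t ht) k x).trans (le_trans ?_ hsmooth)
  gcongr
  exact hg ▸ expect_norm_discreteFourier_conv_muFun_indFun_le hA L

end AlmostPeriods

section Parameters

theorem half_le_log {x : ℝ} (hx : 2 ≤ x) : 1 / 2 ≤ Real.log x := by
  linarith [Real.log_two_gt_d9, Real.log_le_log two_pos hx]

theorem half_le_log_two_div {y : ℝ} (hy : 0 < y) (hy1 : y ≤ 1) : 1 / 2 ≤ Real.log (2 / y) :=
  half_le_log (by rw [le_div_iff₀ hy]; linarith)

theorem one_div_four_pow_ceil_log_le {y : ℝ} (hy : 0 < y) (hy1 : y ≤ 1) :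
    (1 / 4 : ℝ) ^ ⌈4 * Real.log (2 / y)⌉₊ ≤ y / 16 := by
  have hbase : (1 / 4 : ℝ) ≤ Real.exp (-1) := by linarith [Real.exp_neg_one_gt_d9]
  calc (1 / 4 : ℝ) ^ ⌈4 * Real.log (2 / y)⌉₊
      ≤ Real.exp (-1) ^ ⌈4 * Real.log (2 / y)⌉₊ := pow_le_pow_left₀ (by norm_num) hbase _
    _ = Real.exp (-⌈4 * Real.log (2 / y)⌉₊) := by rw [← Real.exp_nat_mul, mul_neg_one]
    _ ≤ Real.exp ((4 : ℕ) * -Real.log (2 / y)) := by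
        refine Real.exp_le_exp.mpr ?_
        push_cast
        linarith [Nat.le_ceil (4 * Real.log (2 / y))]
    _ = y ^ 4 / 16 := by
        rw [Real.exp_nat_mul, Real.exp_neg, Real.exp_log (by positivity), inv_div, div_pow]
        norm_num
    _ ≤ y / 16 := by
        gcongr
        exact pow_le_of_le_one hy.le hy1 (by norm_num)

theorem exists_iteration_count {δ η : ℝ} (hδ : 0 < δ) (hδ1 : δ ≤ 1) (hη : 0 < η) (hη1 : η ≤ 1) :
    ∃ k : ℕ, 1 ≤ k ∧ 2 * k + 3 ≤ 18 * Real.log (2 / (δ * η)) ∧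
      1 / √η * (δ * √η / 8 + 2 * (1 / 4) ^ k) ≤ δ / 4 := by
  have hy : 0 < δ * η := by positivity
  have hy1 : δ * η ≤ 1 := mul_le_one₀ hδ1 hη.le hη1
  have hℓ := half_le_log_two_div hy hy1
  have hη_le_sqrt : δ * η ≤ δ * √η := by
    gcongr
    exact Real.le_sqrt_of_sq_le (pow_le_of_le_one hη.le hη1 two_ne_zero)
  refine ⟨⌈4 * Real.log (2 / (δ * η))⌉₊, Nat.one_le_ceil_iff.mpr (by linarith), ?_, ?_⟩
  · linarith [Nat.ceil_lt_add_one (by linarith : 0 ≤ 4 * Real.log (2 / (δ * η)))]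
  · rw [one_div_mul_eq_div, div_le_iff₀ (by positivity)]
    linarith [one_div_four_pow_ceil_log_le hy hy1]

theorem exists_sample_size_and_rank {m ε ℓ lam σ : ℝ} {k : ℕ} (hm : 1 ≤ m) (hε : 0 < ε)
    (hε1 : ε ≤ 1) (hℓ : 1 / 2 ≤ ℓ) (hlam : 1 / 2 ≤ lam) (hσ : 0 ≤ σ) (hk : 1 ≤ k)
    (hkℓ : 2 * k + 3 ≤ 18 * ℓ) :
    ∃ n l : ℕ, 192 * m ≤ n * (ε / (8 * k)) ^ 2 ∧ 0 < l ∧ 8 * ((n + 3) * lam + σ) < l ∧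
      l ≤ 8000000 * (m * (1 / ε ^ 2) * ℓ ^ 2 * lam + σ) := by
  have : (1 : ℝ) ≤ k := by exact_mod_cast hk
  set Q := m * (1 / ε ^ 2) * ℓ ^ 2 with hQ
  set n := ⌈192 * m / (ε / (8 * k)) ^ 2⌉₊
  set y := 8 * ((n + 3) * lam + σ)
  have hy : 0 ≤ y := by positivity
  have hQ_lower : 1 / 4 ≤ Q := by
    have hmε : 1 ≤ m * (1 / ε ^ 2) :=
      one_le_mul_of_one_le_of_one_le hm ((one_le_div (by positivity)).mpr (pow_le_one₀ hε.le hε1))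
    nlinarith
  have hn : (n : ℝ) ≤ 995328 * Q + 1 := by
    calc (n : ℝ) ≤ 192 * m / (ε / (8 * k)) ^ 2 + 1 := (Nat.ceil_lt_add_one (by positivity)).le
      _ = 12288 * (m * (1 / ε ^ 2)) * (k : ℝ) ^ 2 + 1 := by
          field_simp
          ring
      _ ≤ 12288 * (m * (1 / ε ^ 2)) * (9 * ℓ) ^ 2 + 1 := by gcongr; linarith
      _ = 995328 * Q + 1 := by rw [hQ]; ring
  refine ⟨n, ⌊y⌋₊ + 1, ?_, Nat.succ_pos _, ?_, ?_⟩
  · rw [← div_le_iff₀ (by positivity)]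
    exact Nat.le_ceil _
  · rw [Nat.cast_add_one]
    exact Nat.lt_floor_add_one y
  · have hQlam : 1 / 8 ≤ Q * lam := by nlinarith
    calc ((⌊y⌋₊ + 1 : ℕ) : ℝ) ≤ y + 1 := by
          push_cast
          linarith [Nat.floor_le hy]
      _ ≤ 8 * (995344 * Q * lam + σ) + 1 := by
          gcongr ?_ + 1
          have : n + 3 ≤ 995344 * Q := by linarith
          gcongr
      _ ≤ 8000000 * (Q * lam + σ) := by linarith

theorem boundary_parameter_le {m δ d τ ℓ κ : ℝ} (hm : 1 / 2 ≤ m) (hδ : 0 ≤ δ) (hd : 0 < d)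
    (hℓ : 0 < ℓ) (hκ : κ ≤ 18 * ℓ) (hτ0 : 0 ≤ τ)
    (hτ : τ ≤ (1 / 864 * δ) ^ (2 * m) / (d * ℓ)) :
    12 * d * (κ * τ) ≤ (δ / 4) ^ (2 * m) := by
  rw [le_div_iff₀ (by positivity)] at hτ
  calc 12 * d * (κ * τ) ≤ 12 * d * (18 * ℓ * τ) := by gcongr
    _ = 216 * (τ * (d * ℓ)) := by ring
    _ ≤ 216 ^ (2 * m) * (1 / 864 * δ) ^ (2 * m) := by
        gcongr
        exact Real.self_le_rpow_of_one_le (by norm_num) (by linarith)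
    _ = (216 * (1 / 864 * δ)) ^ (2 * m) := (Real.mul_rpow (by norm_num) (by positivity)).symm
    _ = (δ / 4) ^ (2 * m) := by congr 1; ring

theorem radius_parameter_le {w d l r Q : ℝ} (hd : 0 < d) (hr : 0 ≤ r) (hQ : 0 < Q)
    (hl : l ≤ 8000000 * Q) (hw : w / 8 ≤ 81 * (93312 * d ^ 2 * l) * r) :
    w / (d ^ 2 * (10 ^ 15 * Q)) ≤ r := by
  rw [div_le_iff₀ (by positivity)]
  calc w ≤ 60466176 * (d ^ 2 * r) * l := by linarith
    _ ≤ 60466176 * (d ^ 2 * r) * (8000000 * Q) := by gcongr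
    _ = 483729408000000 * (d ^ 2 * r * Q) := by ring
    _ ≤ 10 ^ 15 * (d ^ 2 * r * Q) := by gcongr; norm_num
    _ = r * (d ^ 2 * (10 ^ 15 * Q)) := by ring

end Parameters

theorem log_one_div_card_div_card_nonneg {α : Type*} {S T : Finset α} (hS : S.Nonempty)
    (hST : S ⊆ T) : 0 ≤ Real.log (1 / ((S.card : ℝ) / T.card)) := by
  refine Real.log_nonneg ?_
  rw [one_div_div, one_le_div (Nat.cast_pos.mpr hS.card_pos)]
  exact_mod_cast Finset.card_le_card hST

theorem mainTheorem5 :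
    ∃ c : ℝ, 0 < c ∧ ∃ C : ℝ, 0 < C ∧
      ∀ (G : Type*) [AddCommGroup G] [Fintype G] [DecidableEq G]
        (m ε δ η K : ℝ) (A L S : Finset G) (B : BohrSet G) (τ : ℝ≥0),
        1 ≤ m → 0 < ε → ε < 1 → 0 < δ → δ < 1 →
        A.Nonempty → L.Nonempty → S.Nonempty →
        η = (A.card : ℝ) / (L.card : ℝ) → η ≤ 1 →
        1 ≤ B.rank → B.radius ≤ 2 →
        B.IsRegular → (B.dilate τ).IsRegular →
        (τ : ℝ) ≤ (c * δ) ^ (2 * m) / ((B.rank : ℝ) * Real.log (2 / (δ * η))) →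
        S ⊆ (B.dilate τ).carrier →
        ((A + S).card : ℝ) ≤ K * (A.card : ℝ) →
        ∃ (d' : ℝ) (T : BohrSet G),
          0 < d' ∧
          d' ≤ C * (m * (1 / ε ^ 2) * Real.log (2 / (δ * η)) ^ 2 * Real.log (2 * K)
              + Real.log (1 / ((S.card : ℝ) / ((B.dilate τ).carrier.card : ℝ)))) ∧
          T.IsRegular ∧ T.IsSub (B.dilate τ) ∧
          (T.rank : ℝ) ≤ (B.rank : ℝ) + d' ∧
          (B.radius : ℝ) * (τ : ℝ) * δ * η ^ (1 / 2 : ℝ) / ((B.rank : ℝ) ^ 2 * d')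
            ≤ (T.radius : ℝ) ∧
          (let g : G → ℝ := conv (muFun A) (indFun L)
           let f : G → ℝ := fun x => g x * (1 - g x)
           let bound : ℝ :=
             ε * avgLpNorm m B.carrier f ^ (1 / 2 : ℝ)
               + ε ^ (2 - 1 / m) * avgLpNorm 1 B.carrier f ^ (1 / (2 * m)) + δ
           (∀ t ∈ T.carrier, avgLpNorm (2 * m) B.carrier (fun x => g (x + t) - g x) ≤ bound) ∧
           avgLpNorm (2 * m) B.carrier
             (fun x => conv g (muFun T.carrier) x - g x) ≤ bound) := by
  refine ⟨1 / 864, by norm_num, 10 ^ 15, by norm_num, ?_⟩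
  intro G _ _ _ m ε δ η K A L S B τ hm hε hε1 hδ hδ1 hA hL hS hη hη1 hd hρ hB hBτ hτ hSB hK
  have hη0 : 0 < η := hη ▸ div_pos (Nat.cast_pos.mpr hA.card_pos) (Nat.cast_pos.mpr hL.card_pos)
  have hd0 : (0 : ℝ) < B.rank := Nat.cast_pos.mpr hd
  have hℓ := half_le_log_two_div (mul_pos hδ hη0) (mul_le_one₀ hδ1.le hη0.le hη1)
  have hlam : 1 / 2 ≤ Real.log (2 * K) :=
    half_le_log (by linarith [one_le_of_card_add_le hA hS hK])
  obtain ⟨k, hk, hkℓ, hsmooth⟩ := exists_iteration_count hδ hδ1.le hη0 hη1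
  obtain ⟨n, l, hn, hl0, hl, hlQ⟩ := exists_sample_size_and_rank hm hε hε1.le hℓ hlam
    (log_one_div_card_div_card_nonneg hS hSB) hk hkℓ
  have hl1 : (1 : ℝ) ≤ l := Nat.one_le_cast.mpr hl0
  have hκ1 : δ * √η / 8 ≤ 1 := by
    linarith [mul_le_one₀ hδ1.le (Real.sqrt_nonneg η) (Real.sqrt_le_one.mpr hη1)]
  obtain ⟨T, hT, hTB, hrank, hradius, htranslate⟩ :=
    B.exists_isSub_forall_avgLpNorm_translate_sub_le hm hε hδ.le hδ1.le hA hS hK hd hρ hB hBτ hSB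
      hk hn (boundary_parameter_le (by linarith) hδ.le hd0 (by linarith) hkℓ τ.coe_nonneg hτ)
      (by positivity) hκ1 (L := L) (by rwa [← hη]) hl0 hl rfl rfl
  have hrank' : (T.rank : ℝ) ≤ B.rank + l := by exact_mod_cast hrank
  refine ⟨_, T, by linarith, le_rfl, hT, hTB, by linarith,
    radius_parameter_le hd0 T.radius.coe_nonneg (by linarith) hlQ ?_, htranslate,
    avgLpNorm_conv_muFun_sub_le (by linarith) B.carrier T.carrier_nonempty
      (fun _ => BohrSet.neg_mem_carrier) htranslate⟩
  rw [← Real.sqrt_eq_rpow]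
  linarith
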